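/- Let $S_1,S_2,S_3,S_4$ be real numbers with $\pi/2>S_4\ge S_3\ge S_2\ge S_1>0$ and $S_4<S_1+S_2+S_3$. Assume also that at least one of the inequalities $$\tan\frac{S_1}{2}>\frac{1-\cos S_4}{2\sqrt{\cos S_4}}\qquad\text{or}\qquad S_4\ge S_3+S_2$$ holds. Then there exists a non-degenerate tetrahedron $T$ in the hyperbolic $3$-space $\mathbb{H}^3$ of curvature $-1$ (that is, the convex hull of four points of $\mathbb{H}^3$ not lying in a common hyperbolic plane) whose four facets, which are geodesic triangles, have areas $S_1,S_2,S_3,S_4$. -/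

import Mathlib

noncomputable section

namespace HypSpace

/-- The Lorentzian bilinear form `-x₀y₀ + x₁y₁ + x₂y₂ + x₃y₃` on `ℝ⁴`. -/
def lorentz (x y : Fin 4 → ℝ) : ℝ :=
  -(x 0 * y 0) + x 1 * y 1 + x 2 * y 2 + x 3 * y 3

/-- Hyperbolic 3-space (curvature `-1`), in the hyperboloid model: the upper sheet of
`⟨x, x⟩ = -1`. Its Riemannian metric is the restriction of the Lorentzian form to the
tangent spaces. -/
def H3 : Set (Fin 4 → ℝ) := {x | lorentz x x = -1 ∧ 0 < x 0}

/-- The hyperbolic plane in `H3` with normal vector `n`, where `0 < ⟨n, n⟩`. -/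
def plane (n : Fin 4 → ℝ) : Set (Fin 4 → ℝ) := {x | x ∈ H3 ∧ lorentz x n = 0}

/-- A tetrahedron in `H3`, given by its four vertices, is non-degenerate if no hyperbolic plane
contains all of the vertices. -/
def NonDegenerate (A : Fin 4 → H3) : Prop :=
  ¬ ∃ n : Fin 4 → ℝ, 0 < lorentz n n ∧ ∀ i, (A i : Fin 4 → ℝ) ∈ plane n

/-- The Riemannian area element `√(E G - F²)` of a parametrized surface `φ` in `H3` at the
parameter `(u, v)`; `E`, `F`, `G` are the coefficients of its first fundamental form. -/
def areaElement (φ : ℝ → ℝ → Fin 4 → ℝ) (u v : ℝ) : ℝ :=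
  let φu := deriv (fun s => φ s v) u
  let φv := deriv (fun t => φ u t) v
  √(lorentz φu φu * lorentz φv φv - lorentz φu φv ^ 2)

/-- Central projection from the origin of the open future light cone onto `H3`. It maps
segments to geodesic segments and (planar) triangles to geodesic triangles. -/
def centralProj (x : Fin 4 → ℝ) : Fin 4 → ℝ := (√(-lorentz x x))⁻¹ • x

/-- Parametrization, over the standard triangle in the plane, of the geodesic triangle in `H3`
with vertices `P`, `Q`, `R`. -/
def triangleMap (P Q R : H3) (u v : ℝ) : Fin 4 → ℝ :=
  centralProj ((1 - u - v) • (P : Fin 4 → ℝ) + u • (Q : Fin 4 → ℝ) + v • (R : Fin 4 → ℝ))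

/-- The standard triangle in the parameter plane. -/
def stdTriangle : Set (ℝ × ℝ) := {s | 0 ≤ s.1 ∧ 0 ≤ s.2 ∧ s.1 + s.2 ≤ 1}

/-- The (Riemannian) area of the geodesic triangle in `H3` with vertices `P`, `Q`, `R`. -/
def triangleArea (P Q R : H3) : ℝ :=
  ∫ s in stdTriangle, areaElement (triangleMap P Q R) s.1 s.2

/-- The area of the facet opposite to the vertex `A i` of the tetrahedron with vertices
`A 0`, `A 1`, `A 2`, `A 3`. -/
def facetArea (A : Fin 4 → H3) (i : Fin 4) : ℝ :=
  triangleArea (A (i.succAbove 0)) (A (i.succAbove 1)) (A (i.succAbove 2))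

end HypSpace

end

noncomputable section

namespace HypSpace

open Real MeasureTheory Set

/-! Work with half-areas sᵢ = Sᵢ/2. Put one vertex O at the centre of the Poincaré ball and P₁, P₂,
P₃ at Euclidean radii x₁, x₂, x₃; let γᵢ be the plane angle at O in the face opposite Pᵢ. That face
has half-area sᵢ as soon as the product of its two radii is Tᵢ = sin sᵢ / sin (γᵢ + sᵢ). So the
plane angles determine a tetrahedron with three prescribed lateral areas, x₁² = T₂T₃/T₁ and
cyclically, provided all xᵢ < 1 (`exists_points_of_angles`). The base area is then one more
equation, expressed by `baseNum`.

Fix γ₁ < γ₂ and move γ₃ from γ₂ - γ₁ to γ₂ + γ₁. Both ends are flat, with base half-areas |s₃ + s₁ -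
s₂| and |s₁ + s₂ - s₃|. If the target lies strictly between them, the intermediate value theorem
gives an interior, hence non-degenerate, solution (`exists_points_of_flat_bounds`).

It remains to choose the base face and γ₁, γ₂ so that the radii stay below 1 all along; here the two
alternative hypotheses enter. The first one amounts to tan² s₄ < sin s₁. When s₁ = s₂ and s₃ = s₄
the target sits on a flat end, and `exists_points_symm` gives an explicit symmetric tetrahedron
instead. Riemannian areas are tied to side lengths by `triangleArea_eq`. -/

/-! ### Lorentzian form and area element of a geodesic triangle. -/

lemma lorentz_comm (x y : Fin 4 → ℝ) : lorentz x y = lorentz y x := by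
  simp only [lorentz]; ring

lemma lorentz_add_left (x y z : Fin 4 → ℝ) : lorentz (x + y) z = lorentz x z + lorentz y z := by
  simp only [lorentz, Pi.add_apply]; ring

lemma lorentz_add_right (x y z : Fin 4 → ℝ) : lorentz x (y + z) = lorentz x y + lorentz x z := by
  simp only [lorentz, Pi.add_apply]; ring

lemma lorentz_sub_left (x y z : Fin 4 → ℝ) : lorentz (x - y) z = lorentz x z - lorentz y z := by
  simp only [lorentz, Pi.sub_apply]; ring

lemma lorentz_sub_right (x y z : Fin 4 → ℝ) : lorentz x (y - z) = lorentz x y - lorentz x z := by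
  simp only [lorentz, Pi.sub_apply]; ring

lemma lorentz_smul_left (r : ℝ) (x y : Fin 4 → ℝ) : lorentz (r • x) y = r * lorentz x y := by
  simp only [lorentz, Pi.smul_apply, smul_eq_mul]; ring

lemma lorentz_smul_right (r : ℝ) (x y : Fin 4 → ℝ) : lorentz x (r • y) = r * lorentz x y := by
  simp only [lorentz, Pi.smul_apply, smul_eq_mul]; ring

/-- The reversed Cauchy-Schwarz inequality on the hyperboloid. -/
lemma one_le_neg_lorentz (P Q : H3) : 1 ≤ -lorentz P Q := by
  obtain ⟨x, hx, hx0⟩ := P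
  obtain ⟨y, hy, hy0⟩ := Q
  by_contra! hlt
  simp only [lorentz] at hx hy hlt
  have h1 : 0 < x 0 * y 0 := mul_pos hx0 hy0
  have h2 : x 0 ^ 2 = 1 + x 1 ^ 2 + x 2 ^ 2 + x 3 ^ 2 := by linarith
  have h3 : y 0 ^ 2 = 1 + y 1 ^ 2 + y 2 ^ 2 + y 3 ^ 2 := by linarith
  have h4 : (x 0 * y 0) ^ 2 < (1 + x 1 * y 1 + x 2 * y 2 + x 3 * y 3) ^ 2 :=
    pow_lt_pow_left₀ (by linarith) h1.le two_ne_zero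
  rw [mul_pow, h2, h3] at h4
  linarith [sq_nonneg (x 1 - y 1), sq_nonneg (x 2 - y 2), sq_nonneg (x 3 - y 3),
    sq_nonneg (x 1 * y 2 - x 2 * y 1), sq_nonneg (x 1 * y 3 - x 3 * y 1),
    sq_nonneg (x 2 * y 3 - x 3 * y 2)]

lemma hasDerivAt_lorentz_self {X : ℝ → Fin 4 → ℝ} {Y : Fin 4 → ℝ} {t : ℝ}
    (hX : HasDerivAt X Y t) :
    HasDerivAt (fun s => lorentz (X s) (X s)) (2 * lorentz (X t) Y) t := by
  have h := fun i => (hasDerivAt_pi.1 hX i)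
  have := ((((h 0).mul (h 0)).neg.add ((h 1).mul (h 1))).add ((h 2).mul (h 2))).add
    ((h 3).mul (h 3))
  refine this.congr_deriv ?_
  simp only [lorentz]; ring

lemma hasDerivAt_centralProj {X : ℝ → Fin 4 → ℝ} {Y : Fin 4 → ℝ} {t : ℝ}
    (hX : HasDerivAt X Y t) (hpos : 0 < -lorentz (X t) (X t)) :
    HasDerivAt (fun s => centralProj (X s))
      ((√(-lorentz (X t) (X t)))⁻¹ • Y +
        (lorentz (X t) Y * ((√(-lorentz (X t) (X t)))⁻¹) ^ 3) • X t) t := by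
  have h0 : HasDerivAt (fun s => -lorentz (X s) (X s)) (-(2 * lorentz (X t) Y)) t :=
    (hasDerivAt_lorentz_self hX).neg
  have h1 := (h0.sqrt hpos.ne').inv (sqrt_pos.2 hpos).ne'
  have h2 := h1.smul hX
  have hs := (sqrt_pos.2 hpos).ne'
  refine h2.congr_deriv ?_
  congr 2
  field_simp

/-- U and V are n times the components of Y and Z orthogonal to X, so eliminating X from the Gram
determinant of X, Y, Z leaves theirs. -/
lemma gram_centralProj (X Y Z : Fin 4 → ℝ) (hpos : 0 < -lorentz X X) :
    let n := (√(-lorentz X X))⁻¹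
    let U := n • Y + (lorentz X Y * n ^ 3) • X
    let V := n • Z + (lorentz X Z * n ^ 3) • X
    lorentz U U * lorentz V V - lorentz U V ^ 2 =
      -(lorentz X X * lorentz Y Y * lorentz Z Z
        + 2 * lorentz X Y * lorentz Y Z * lorentz X Z
        - lorentz X X * lorentz Y Z ^ 2 - lorentz Y Y * lorentz X Z ^ 2
        - lorentz Z Z * lorentz X Y ^ 2) / (-lorentz X X) ^ 3 := by
  intro n U V
  have hn : n ^ 2 * (-lorentz X X) = 1 := by
    simp only [n, inv_pow, sq_sqrt hpos.le]
    exact inv_mul_cancel₀ hpos.ne'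
  have hXX : lorentz X X = -(n ^ 2)⁻¹ := by
    have : n ^ 2 ≠ 0 := by rintro h; simp [h] at hn
    rw [← neg_eq_iff_eq_neg]; exact eq_inv_of_mul_eq_one_right hn
  have hn0 : n ≠ 0 := by rintro h; simp [h] at hn
  simp only [U, V, lorentz_add_left, lorentz_add_right, lorentz_smul_left, lorentz_smul_right,
    lorentz_comm Y X, lorentz_comm Z X, hXX]
  field_simp
  ring

/-- The squared Lorentzian length of a point of a triangle in the ambient space, in terms of the
hyperbolic cosines of the sides. -/
def sqLen (a b c u v : ℝ) : ℝ :=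
  (1 - u - v) ^ 2 + u ^ 2 + v ^ 2 + 2 * (1 - u - v) * u * a + 2 * (1 - u - v) * v * b
    + 2 * u * v * c

lemma sqLen_pos {a b c u v : ℝ} (ha : 1 ≤ a) (hb : 1 ≤ b) (hc : 1 ≤ c)
    (hu : 0 ≤ u) (hv : 0 ≤ v) (huv : u + v ≤ 1) : 0 < sqLen a b c u v := by
  have h0 : 0 ≤ 1 - u - v := by linarith
  have h1 : sqLen a b c u v = 1 + 2 * ((1 - u - v) * u) * (a - 1)
      + 2 * ((1 - u - v) * v) * (b - 1) + 2 * (u * v) * (c - 1) := by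
    simp only [sqLen]; ring
  have := mul_nonneg (mul_nonneg h0 hu) (sub_nonneg.2 ha)
  have := mul_nonneg (mul_nonneg h0 hv) (sub_nonneg.2 hb)
  have := mul_nonneg (mul_nonneg hu hv) (sub_nonneg.2 hc)
  rw [h1]; linarith

/-- Minus the Gram determinant of three points of the hyperboloid, in terms of the hyperbolic
cosines of their distances. -/
def negGram (a b c : ℝ) : ℝ := 1 + 2 * a * b * c - a ^ 2 - b ^ 2 - c ^ 2

lemma areaElement_triangleMap (P Q R : H3) {u v : ℝ}
    (hu : 0 ≤ u) (hv : 0 ≤ v) (huv : u + v ≤ 1) :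
    areaElement (triangleMap P Q R) u v =
      √(negGram (-lorentz P Q) (-lorentz P R) (-lorentz Q R) /
        sqLen (-lorentz P Q) (-lorentz P R) (-lorentz Q R) u v ^ 3) := by
  set X : Fin 4 → ℝ := (1 - u - v) • (P : Fin 4 → ℝ) + u • (Q : Fin 4 → ℝ) + v • (R : Fin 4 → ℝ)
    with hX
  have hP : lorentz (P : Fin 4 → ℝ) P = -1 := P.2.1
  have hQ : lorentz (Q : Fin 4 → ℝ) Q = -1 := Q.2.1
  have hR : lorentz (R : Fin 4 → ℝ) R = -1 := R.2.1
  have hXX : -lorentz X X = sqLen (-lorentz P Q) (-lorentz P R) (-lorentz Q R) u v := by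
    simp only [hX, lorentz_add_left, lorentz_add_right, lorentz_smul_left, lorentz_smul_right,
      lorentz_comm Q P, lorentz_comm R P, lorentz_comm R Q, hP, hQ, hR, sqLen]
    ring
  have hpos : 0 < -lorentz X X := by
    rw [hXX]
    exact sqLen_pos (one_le_neg_lorentz P Q) (one_le_neg_lorentz P R) (one_le_neg_lorentz Q R)
      hu hv huv
  have hdu : HasDerivAt (fun s : ℝ => (1 - s - v) • (P : Fin 4 → ℝ) + s • (Q : Fin 4 → ℝ)
      + v • (R : Fin 4 → ℝ)) ((Q : Fin 4 → ℝ) - P) u := by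
    have := (((((hasDerivAt_id u).const_sub 1).sub_const v).smul_const (P : Fin 4 → ℝ)).add
      ((hasDerivAt_id u).smul_const (Q : Fin 4 → ℝ))).add_const (v • (R : Fin 4 → ℝ))
    refine this.congr_deriv ?_
    module
  have hdv : HasDerivAt (fun s : ℝ => (1 - u - s) • (P : Fin 4 → ℝ) + u • (Q : Fin 4 → ℝ)
      + s • (R : Fin 4 → ℝ)) ((R : Fin 4 → ℝ) - P) v := by
    have := (((((hasDerivAt_id v).const_sub (1 - u)).smul_const (P : Fin 4 → ℝ)).add_const
      (u • (Q : Fin 4 → ℝ)))).add ((hasDerivAt_id v).smul_const (R : Fin 4 → ℝ))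
    refine this.congr_deriv ?_
    module
  have h1 := (hasDerivAt_centralProj hdu hpos).deriv
  have h2 := (hasDerivAt_centralProj hdv hpos).deriv
  simp only [areaElement, triangleMap]
  rw [h1, h2, gram_centralProj X _ _ hpos, hXX]
  congr 2
  -- Passing from P, Q, R to X, Q - P, R - P has determinant 1, so the Gram determinant does not
  -- depend on u, v.
  simp only [hX, lorentz_add_left, lorentz_add_right, lorentz_smul_left, lorentz_smul_right,
    lorentz_sub_left, lorentz_sub_right,
    lorentz_comm Q P, lorentz_comm R P, lorentz_comm R Q, hP, hQ, hR, negGram]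
  ring

/-! ### Integration over the triangle and the closed area formula. -/

/-- The cone parametrization of the standard triangle. -/
def coneMap (x : ℝ × ℝ) : ℝ × ℝ := (x.2 * (1 - x.1), x.2 * x.1)

/-- The derivative of the cone parametrization. -/
def fderivConeMap (x : ℝ × ℝ) : ℝ × ℝ →L[ℝ] ℝ × ℝ :=
  (Matrix.toLin (.finTwoProd ℝ) (.finTwoProd ℝ)
    !![-x.2, 1 - x.1; x.2, x.1]).toContinuousLinearMap

lemma hasFDerivAt_coneMap (x : ℝ × ℝ) : HasFDerivAt coneMap (fderivConeMap x) x := by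
  unfold fderivConeMap
  rw [Matrix.toLin_finTwoProd_toContinuousLinearMap]
  have h := HasFDerivAt.prodMk (𝕜 := ℝ)
    ((hasFDerivAt_snd (𝕜 := ℝ) (p := x)).mul ((hasFDerivAt_fst (𝕜 := ℝ) (p := x)).const_sub 1))
    ((hasFDerivAt_snd (𝕜 := ℝ) (p := x)).mul (hasFDerivAt_fst (𝕜 := ℝ) (p := x)))
  refine h.congr_fderiv ?_
  ext <;> simp

lemma det_fderivConeMap (x : ℝ × ℝ) : (fderivConeMap x).det = -x.2 := by
  unfold fderivConeMap
  simp only [LinearMap.det_toContinuousLinearMap, LinearMap.det_toLin, Matrix.det_fin_two_of]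
  ring

lemma injOn_coneMap : InjOn coneMap (Icc 0 1 ×ˢ Ioc 0 1) := by
  rintro ⟨t, r⟩ ⟨-, hr⟩ ⟨t', r'⟩ - h
  simp only [coneMap, Prod.mk.injEq] at h hr
  obtain ⟨h1, h2⟩ := h
  have h3 : r = r' := by linarith
  subst h3
  have := mul_left_cancel₀ hr.1.ne' h2
  simp [this]

lemma image_coneMap : coneMap '' (Icc 0 1 ×ˢ Ioc 0 1) = stdTriangle \ {(0, 0)} := by
  ext ⟨u, v⟩
  simp only [mem_image, mem_prod, mem_Icc, mem_Ioc, Prod.exists, coneMap, Prod.mk.injEq,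
    stdTriangle, mem_sdiff, mem_ofPred_eq, mem_singleton_iff]
  constructor
  · rintro ⟨t, r, ⟨⟨ht0, ht1⟩, hr0, hr1⟩, rfl, rfl⟩
    refine ⟨⟨by nlinarith, by nlinarith, by linarith⟩, ?_⟩
    rintro ⟨h1, h2⟩
    linarith
  · rintro ⟨⟨hu, hv, huv⟩, hne⟩
    have hpos : 0 < u + v := by
      rcases hu.lt_or_eq with h | h
      · linarith
      rcases hv.lt_or_eq with h' | h'
      · linarith
      exact absurd ⟨h.symm, h'.symm⟩ hne
    refine ⟨v / (u + v), u + v, ⟨⟨by positivity, ?_⟩, hpos, huv⟩, ?_, ?_⟩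
    · rw [div_le_one hpos]; linarith
    · field_simp; ring
    · field_simp

/-- The Jacobian of the cone map is r up to sign; the map collapses only r = 0, whose image is the
null set removed here. -/
lemma integral_stdTriangle (f : ℝ × ℝ → ℝ)
    (hf : ContinuousOn (fun x => f (coneMap x)) (Icc 0 1 ×ˢ Icc 0 1)) :
    ∫ s in stdTriangle, f s =
      ∫ t in (0 : ℝ)..1, ∫ r in (0 : ℝ)..1, r * f (coneMap (t, r)) := by
  have hae : (stdTriangle \ {(0, 0)} : Set (ℝ × ℝ)) =ᵐ[volume] stdTriangle :=
    sdiff_null_ae_eq_self (measure_singleton _)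
  have hS : MeasurableSet (Icc (0 : ℝ) 1 ×ˢ Ioc (0 : ℝ) 1) :=
    measurableSet_Icc.prod measurableSet_Ioc
  rw [← setIntegral_congr_set hae, ← image_coneMap,
    integral_image_eq_integral_abs_det_fderiv_smul volume hS
      (fun x _ => (hasFDerivAt_coneMap x).hasFDerivWithinAt) injOn_coneMap]
  have h1 : ∫ x in Icc (0 : ℝ) 1 ×ˢ Ioc (0 : ℝ) 1, |(fderivConeMap x).det| • f (coneMap x) =
      ∫ x in Icc (0 : ℝ) 1 ×ˢ Ioc (0 : ℝ) 1, x.2 * f (coneMap x) := by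
    refine setIntegral_congr_fun hS fun x hx => ?_
    simp only [det_fderivConeMap, abs_neg, abs_of_pos hx.2.1, smul_eq_mul]
  have hint : IntegrableOn (fun x : ℝ × ℝ => x.2 * f (coneMap x))
      (Icc (0 : ℝ) 1 ×ˢ Ioc (0 : ℝ) 1) (volume.prod volume) := by
    refine IntegrableOn.mono_set (t := Icc (0 : ℝ) 1 ×ˢ Icc (0 : ℝ) 1) ?_
      (prod_mono le_rfl Ioc_subset_Icc_self)
    exact ContinuousOn.integrableOn_compact (isCompact_Icc.prod isCompact_Icc)
      (continuous_snd.continuousOn.mul hf)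
  rw [h1, Measure.volume_eq_prod, setIntegral_prod _ hint,
    intervalIntegral.integral_of_le zero_le_one, integral_Icc_eq_integral_Ioc]
  simp only [intervalIntegral.integral_of_le zero_le_one]

/-- With q the quadratic and l = 1 + B r, the usual primitive (1 - l/√q)/(C - B²) is rationalised by
q - l² = (C - B²) r²; this form survives C = B². -/
lemma hasDerivAt_radial {B C r : ℝ} (hq : 0 < 1 + 2 * B * r + C * r ^ 2) (hl : 0 < 1 + B * r) :
    HasDerivAt (fun r => r ^ 2 / (1 + 2 * B * r + C * r ^ 2 +
        (1 + B * r) * √(1 + 2 * B * r + C * r ^ 2)))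
      (r / √(1 + 2 * B * r + C * r ^ 2) ^ 3) r := by
  have h1 : HasDerivAt (fun r => 1 + 2 * B * r + C * r ^ 2) (2 * B + C * (2 * r)) r := by
    have := (((hasDerivAt_id r).const_mul (2 * B)).const_add 1).add
      ((hasDerivAt_pow 2 r).const_mul C)
    refine this.congr_deriv ?_
    simp
  have h2 : HasDerivAt (fun r => 1 + B * r) B r := by
    simpa using ((hasDerivAt_id r).const_mul B).const_add 1
  have hs := sqrt_pos.2 hq
  have hσ := sq_sqrt hq.le
  have hden : 1 + 2 * B * r + C * r ^ 2 + (1 + B * r) * √(1 + 2 * B * r + C * r ^ 2) ≠ 0 := by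
    positivity
  have h3 := (hasDerivAt_pow 2 r).fun_div (h1.fun_add (h2.fun_mul (h1.sqrt hq.ne'))) hden
  refine h3.congr_deriv ?_
  set σ := √(1 + 2 * B * r + C * r ^ 2)
  have hC : 1 + 2 * B * r + C * r ^ 2 = σ ^ 2 := hσ.symm
  have hl' : 0 < σ + (1 + B * r) := by positivity
  rw [hC, div_eq_div_iff (by positivity) (by positivity)]
  have hdiv : (2 * B + C * (2 * r)) / (2 * σ) = (B + C * r) / σ := by field_simp
  rw [hdiv]
  field_simp
  push_cast
  linear_combination (-r * (2 * σ + (1 + B * r))) * hC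

lemma integral_radial {B C : ℝ} (hl : 0 < 1 + B)
    (hq : ∀ r ∈ Icc (0 : ℝ) 1, 0 < 1 + 2 * B * r + C * r ^ 2) :
    ∫ r in (0 : ℝ)..1, r / √(1 + 2 * B * r + C * r ^ 2) ^ 3 =
      1 / (√(1 + 2 * B + C) * (1 + B + √(1 + 2 * B + C))) := by
  have hq1 : 0 < 1 + 2 * B + C := by simpa using hq 1 (by simp)
  rw [intervalIntegral.integral_eq_sub_of_hasDerivAt (f := fun r => r ^ 2 / (1 + 2 * B * r +
    C * r ^ 2 + (1 + B * r) * √(1 + 2 * B * r + C * r ^ 2)))]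
  · have hs := sqrt_pos.2 hq1
    simp only [mul_one, one_pow, mul_zero, zero_pow two_ne_zero, zero_div, sub_zero]
    congr 1
    linear_combination -sq_sqrt hq1.le
  · intro r hr
    rw [uIcc_of_le zero_le_one] at hr
    refine hasDerivAt_radial (hq r hr) ?_
    rcases hr.2.lt_or_eq with h | h
    · linarith [mul_nonneg hr.1 hl.le]
    · rw [h]; linarith
  · apply ContinuousOn.intervalIntegrable
    rw [uIcc_of_le zero_le_one]
    refine continuousOn_id.div (by fun_prop) fun r hr => ?_
    exact (pow_pos (sqrt_pos.2 (hq r hr)) 3).ne'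

/-- The primitive is the area formula itself, for the subtriangle P Q R_t with R_t the normalisation
of (1 - t) Q + t R, whose squared length is the radicand. -/
lemma hasDerivAt_areaFormula {a b c t : ℝ} (ha : 1 ≤ a) (hb : 1 ≤ b) (hc : 1 ≤ c)
    (hG : 0 ≤ negGram a b c) (ht : t ∈ Icc (0 : ℝ) 1) :
    HasDerivAt (fun t => 2 * arctan (t * √(negGram a b c) /
        ((1 + a) * (√(1 + 2 * t * (1 - t) * (c - 1)) + 1 - t) + t * (b + c))))
      (√(negGram a b c) / (√(1 + 2 * t * (1 - t) * (c - 1)) *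
        ((1 - t) * a + t * b + √(1 + 2 * t * (1 - t) * (c - 1))))) t := by
  obtain ⟨ht0, ht1⟩ := ht
  set g := √(negGram a b c)
  have hg : g ^ 2 = negGram a b c := sq_sqrt hG
  have ht1' : 0 ≤ 1 - t := by linarith
  have hw : 0 < 1 + 2 * t * (1 - t) * (c - 1) := by
    have := mul_nonneg (mul_nonneg ht0 ht1') (sub_nonneg.2 hc)
    linarith
  have h1 : HasDerivAt (fun t => 1 + 2 * t * (1 - t) * (c - 1)) (2 * (1 - 2 * t) * (c - 1)) t := by
    have := ((((hasDerivAt_id t).const_mul 2).fun_mul ((hasDerivAt_id t).const_sub 1)).mul_const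
      (c - 1)).const_add 1
    refine this.congr_deriv ?_
    simp only [id]
    ring
  have h2 := (((h1.sqrt hw.ne').add_const 1).fun_sub (hasDerivAt_id t)).const_mul (1 + a)
  have h3 := h2.fun_add ((hasDerivAt_id t).mul_const (b + c))
  have hσ := sq_sqrt hw.le
  have hs := sqrt_pos.2 hw
  simp only [id] at h3
  have hD : 0 < (1 + a) * (√(1 + 2 * t * (1 - t) * (c - 1)) + 1 - t) + t * (b + c) := by
    have : 0 < √(1 + 2 * t * (1 - t) * (c - 1)) + 1 - t := by linarith
    have h5 : 0 ≤ t * (b + c) := mul_nonneg ht0 (by linarith)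
    have h6 : 0 < 1 + a := by linarith
    positivity
  have h4 := ((((hasDerivAt_id t).mul_const g).fun_div h3 hD.ne').arctan).const_mul 2
  simp only [id] at h4
  refine h4.congr_deriv ?_
  set σ := √(1 + 2 * t * (1 - t) * (c - 1))
  have hp : 0 < (1 - t) * a + t * b + σ := by
    have := mul_nonneg ht1' (zero_le_one.trans ha)
    have := mul_nonneg ht0 (zero_le_one.trans hb)
    linarith
  have hq : 0 < 1 + t * (c - 1) + σ := by
    have := mul_nonneg ht0 (sub_nonneg.2 hc)
    linarith
  have h1a : 0 < 1 + a := by linarith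
  set D := (1 + a) * (σ + 1 - t) + t * (b + c) with hDdef
  -- The identity (1+a+b+c)² + `negGram a b c` = 2(1+a)(1+b)(1+c), applied to the subtriangle and
  -- cleared of denominators.
  have key1 : D ^ 2 + (t * g) ^ 2 =
      2 * (1 + a) * (1 + t * (c - 1) + σ) * ((1 - t) * a + t * b + σ) := by
    rw [mul_pow, hg, hDdef, negGram]
    linear_combination (a ^ 2 - 1) * hσ
  have key2 : (1 * g * D - t * g * ((1 + a) * (2 * (1 - 2 * t) * (c - 1) / (2 * σ) - 1) +
      1 * (b + c))) = g * (1 + a) * (1 + t * (c - 1) + σ) / σ := by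
    rw [hDdef]
    field_simp
    linear_combination g * (1 + a) * hσ
  have h5 : 1 + (t * g / D) ^ 2 = (D ^ 2 + (t * g) ^ 2) / D ^ 2 := by field_simp
  rw [key2, h5, key1]
  field_simp

lemma triangleArea_eq (P Q R : H3)
    (hG : 0 ≤ negGram (-lorentz P Q) (-lorentz P R) (-lorentz Q R)) :
    triangleArea P Q R = 2 * arctan (√(negGram (-lorentz P Q) (-lorentz P R) (-lorentz Q R)) /
      (1 + -lorentz P Q + -lorentz P R + -lorentz Q R)) := by
  have ha := one_le_neg_lorentz P Q
  have hb := one_le_neg_lorentz P R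
  have hc := one_le_neg_lorentz Q R
  have h0 : triangleArea P Q R = ∫ s in stdTriangle,
      √(negGram (-lorentz P Q) (-lorentz P R) (-lorentz Q R) /
        sqLen (-lorentz P Q) (-lorentz P R) (-lorentz Q R) s.1 s.2 ^ 3) := by
    refine setIntegral_congr_fun ?_ fun s hs => areaElement_triangleMap P Q R hs.1 hs.2.1 hs.2.2
    refine IsClosed.measurableSet ?_
    have : stdTriangle = {s : ℝ × ℝ | 0 ≤ s.1} ∩ ({s | 0 ≤ s.2} ∩ {s | s.1 + s.2 ≤ 1}) := rfl
    rw [this]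
    exact (isClosed_le (by fun_prop) (by fun_prop)).inter
      ((isClosed_le (by fun_prop) (by fun_prop)).inter (isClosed_le (by fun_prop) (by fun_prop)))
  rw [h0]
  generalize -lorentz P Q = a at *
  generalize -lorentz P R = b at *
  generalize -lorentz Q R = c at *
  have hpos : ∀ t ∈ Icc (0 : ℝ) 1, ∀ r ∈ Icc (0 : ℝ) 1,
      0 < sqLen a b c (r * (1 - t)) (r * t) := fun t ht r hr =>
    sqLen_pos ha hb hc (mul_nonneg hr.1 (sub_nonneg.2 ht.2)) (mul_nonneg hr.1 ht.1)
      (by linarith [hr.2])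
  have hw : ∀ t ∈ Icc (0 : ℝ) 1, 0 < 1 + 2 * t * (1 - t) * (c - 1) := fun t ht => by
    have := mul_nonneg (mul_nonneg ht.1 (sub_nonneg.2 ht.2)) (sub_nonneg.2 hc)
    linarith
  have hp : ∀ t ∈ Icc (0 : ℝ) 1, 0 < (1 - t) * a + t * b := fun t ht => by
    nlinarith [ht.1, ht.2, mul_nonneg ht.1 (sub_nonneg.2 hb),
      mul_nonneg (sub_nonneg.2 ht.2) (sub_nonneg.2 ha)]
  rw [integral_stdTriangle]
  · have h1 : ∀ t ∈ Icc (0 : ℝ) 1, ∫ r in (0 : ℝ)..1, r * √(negGram a b c /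
        sqLen a b c (coneMap (t, r)).1 (coneMap (t, r)).2 ^ 3) =
        √(negGram a b c) / (√(1 + 2 * t * (1 - t) * (c - 1)) *
        ((1 - t) * a + t * b + √(1 + 2 * t * (1 - t) * (c - 1)))) := by
      intro t ht
      set B := (1 - t) * a + t * b - 1 with hB
      -- B and C are the coefficients of `sqLen` along the ray; its value at r = 1 is the radicand
      -- in t.
      set C := 1 + 2 * t * (1 - t) * (c - 1) - 1 - 2 * B with hC
      have hlen : ∀ r, sqLen a b c (r * (1 - t)) (r * t) = 1 + 2 * B * r + C * r ^ 2 := by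
        intro r; simp only [hC, hB, sqLen]; ring
      have hrad := integral_radial (B := B) (C := C) (by linarith [hp t ht])
        (fun r hr => hlen r ▸ hpos t ht r hr)
      have h2 : ∀ r ∈ uIcc (0 : ℝ) 1, r * √(negGram a b c /
          sqLen a b c (coneMap (t, r)).1 (coneMap (t, r)).2 ^ 3) =
          √(negGram a b c) * (r / √(1 + 2 * B * r + C * r ^ 2) ^ 3) := by
        intro r hr
        rw [uIcc_of_le zero_le_one] at hr
        have h3 := hpos t ht r hr
        simp only [coneMap]
        rw [hlen] at h3 ⊢
        rw [sqrt_div hG, show (1 + 2 * B * r + C * r ^ 2) ^ 3 =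
          (1 + 2 * B * r + C * r ^ 2) ^ 2 * (1 + 2 * B * r + C * r ^ 2) by ring,
          sqrt_mul (by positivity), sqrt_sq h3.le]
        have := sq_sqrt h3.le
        rw [show √(1 + 2 * B * r + C * r ^ 2) ^ 3 = √(1 + 2 * B * r + C * r ^ 2) ^ 2 *
          √(1 + 2 * B * r + C * r ^ 2) by ring, this]
        ring
      rw [intervalIntegral.integral_congr h2, intervalIntegral.integral_const_mul, hrad]
      rw [show 1 + 2 * B + C = 1 + 2 * t * (1 - t) * (c - 1) by rw [hC]; ring,
        show 1 + B = (1 - t) * a + t * b by rw [hB]; ring, mul_one_div]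
    rw [intervalIntegral.integral_congr (g := fun t => √(negGram a b c) /
        (√(1 + 2 * t * (1 - t) * (c - 1)) *
        ((1 - t) * a + t * b + √(1 + 2 * t * (1 - t) * (c - 1)))))
        (fun t ht => h1 t (by rwa [uIcc_of_le zero_le_one] at ht)),
      intervalIntegral.integral_eq_sub_of_hasDerivAt
        (fun t ht => hasDerivAt_areaFormula ha hb hc hG (by rwa [uIcc_of_le zero_le_one] at ht))]
    · simp [← add_assoc]
    · apply ContinuousOn.intervalIntegrable
      rw [uIcc_of_le zero_le_one]
      refine continuousOn_const.div (by fun_prop) fun t ht => ?_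
      have := hp t ht
      have := sqrt_pos.2 (hw t ht)
      positivity
  · refine ContinuousOn.sqrt (continuousOn_const.div ?_ ?_)
    · unfold sqLen coneMap; fun_prop
    · rintro ⟨t, r⟩ ⟨ht, hr⟩
      exact (pow_pos (hpos t ht r hr) 3).ne'

/-! ### From areas to an algebraic condition on the sides. -/

/-- The half-angle characterization of the area of a hyperbolic triangle with given sides. -/
lemma triangleArea_eq_of_cos (P Q R : H3) {s : ℝ} (hs0 : 0 ≤ s) (hs : s < π / 2)
    (h : (1 + -lorentz P Q + -lorentz P R + -lorentz Q R) ^ 2 = 2 * cos s ^ 2 *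
      ((1 + -lorentz P Q) * (1 + -lorentz P R) * (1 + -lorentz Q R))) :
    triangleArea P Q R = 2 * s := by
  have ha := one_le_neg_lorentz P Q
  have hb := one_le_neg_lorentz P R
  have hc := one_le_neg_lorentz Q R
  have hG : negGram (-lorentz P Q) (-lorentz P R) (-lorentz Q R) =
      (tan s * (1 + -lorentz P Q + -lorentz P R + -lorentz Q R)) ^ 2 := by
    have hcos : cos s ≠ 0 := (cos_pos_of_mem_Ioo ⟨by linarith [pi_pos], hs⟩).ne'
    rw [mul_pow, tan_eq_sin_div_cos, div_pow, h, sin_sq]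
    field_simp
    simp only [negGram]
    linear_combination -h
  have htan : 0 ≤ tan s := tan_nonneg_of_nonneg_of_le_pi_div_two hs0 hs.le
  have hpos : 0 < 1 + -lorentz P Q + -lorentz P R + -lorentz Q R := by linarith
  rw [triangleArea_eq P Q R (hG ▸ sq_nonneg _), hG, sqrt_sq (by positivity),
    mul_div_cancel_right₀ _ hpos.ne', arctan_tan (by linarith [pi_pos]) hs]

/-- The sides of the triangle `P Q R` are those of a triangle of area `2 * s`. -/
def HasHalfArea (P Q R : H3) (s : ℝ) : Prop :=
  (1 + -lorentz P Q + -lorentz P R + -lorentz Q R) ^ 2 = 2 * cos s ^ 2 *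
    ((1 + -lorentz P Q) * (1 + -lorentz P R) * (1 + -lorentz Q R))

lemma HasHalfArea.swap_left {P Q R : H3} {s : ℝ} (h : HasHalfArea P Q R s) :
    HasHalfArea Q P R s := by
  unfold HasHalfArea at *
  rw [lorentz_comm Q P]
  linear_combination h

lemma HasHalfArea.swap_right {P Q R : H3} {s : ℝ} (h : HasHalfArea P Q R s) :
    HasHalfArea P R Q s := by
  unfold HasHalfArea at *
  rw [lorentz_comm R Q]
  linear_combination h

/-- No hyperbolic plane contains the four points. -/
def NotCoplanar (P Q R S : H3) : Prop :=
  ∀ n : Fin 4 → ℝ, lorentz P n = 0 → lorentz Q n = 0 → lorentz R n = 0 → lorentz S n = 0 →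
    lorentz n n ≤ 0

lemma NotCoplanar.nonDegenerate {P Q R S : H3} (h : NotCoplanar P Q R S) :
    NonDegenerate ![P, Q, R, S] := by
  rintro ⟨n, hn, hA⟩
  exact absurd (h n (hA 0).2 (hA 1).2 (hA 2).2 (hA 3).2) (not_le.2 hn)

lemma exists_facetArea {P Q R S : H3} {s₁ s₂ s₃ s₄ : ℝ} (hn : NotCoplanar P Q R S)
    (h₁ : HasHalfArea Q R S s₁) (h₂ : HasHalfArea P R S s₂)
    (h₃ : HasHalfArea P Q S s₃) (h₄ : HasHalfArea P Q R s₄)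
    (hs₁ : s₁ ∈ Ico 0 (π / 2)) (hs₂ : s₂ ∈ Ico 0 (π / 2)) (hs₃ : s₃ ∈ Ico 0 (π / 2))
    (hs₄ : s₄ ∈ Ico 0 (π / 2)) :
    ∃ A : Fin 4 → H3, NonDegenerate A ∧ facetArea A 0 = 2 * s₁ ∧ facetArea A 1 = 2 * s₂ ∧
      facetArea A 2 = 2 * s₃ ∧ facetArea A 3 = 2 * s₄ :=
  ⟨![P, Q, R, S], hn.nonDegenerate, triangleArea_eq_of_cos Q R S hs₁.1 hs₁.2 h₁,
    triangleArea_eq_of_cos P R S hs₂.1 hs₂.2 h₂, triangleArea_eq_of_cos P Q S hs₃.1 hs₃.2 h₃,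
    triangleArea_eq_of_cos P Q R hs₄.1 hs₄.2 h₄⟩

/-! ### Tetrahedra with a vertex at the centre of the Poincaré ball. -/

/-- The point of the hyperboloid with coordinates `(x, y, z)` in the Poincaré ball. -/
def ballPoint (m x y z : ℝ) (h : x ^ 2 + y ^ 2 + z ^ 2 = m) (hm : m < 1) : H3 :=
  ⟨![(1 + m) / (1 - m), 2 * x / (1 - m), 2 * y / (1 - m), 2 * z / (1 - m)], by
    have hm' : 0 < 1 - m := by linarith
    have hm0 : 0 ≤ m := h ▸ by positivity
    constructor
    · simp only [lorentz, Matrix.cons_val]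
      field_simp
      linear_combination 4 * h
    · simp only [Matrix.cons_val]
      positivity⟩

lemma neg_lorentz_ballPoint {m x y z m' x' y' z' : ℝ} (h : x ^ 2 + y ^ 2 + z ^ 2 = m)
    (hm : m < 1) (h' : x' ^ 2 + y' ^ 2 + z' ^ 2 = m') (hm' : m' < 1) :
    -lorentz (ballPoint m x y z h hm) (ballPoint m' x' y' z' h' hm') =
      ((1 + m) * (1 + m') - 4 * (x * x' + y * y' + z * z')) / ((1 - m) * (1 - m')) := by
  have h1 : 1 - m ≠ 0 := by linarith
  have h2 : 1 - m' ≠ 0 := by linarith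
  simp only [ballPoint, lorentz, Matrix.cons_val]
  field_simp
  ring

lemma lorentz_ballPoint_eq_zero {m x y z : ℝ} (h : x ^ 2 + y ^ 2 + z ^ 2 = m) (hm : m < 1)
    {n : Fin 4 → ℝ} (hn : lorentz (ballPoint m x y z h hm) n = 0) :
    -((1 + m) * n 0) + 2 * (x * n 1 + y * n 2 + z * n 3) = 0 := by
  have h1 : 1 - m ≠ 0 := by linarith
  simp only [ballPoint, lorentz, Matrix.cons_val] at hn
  field_simp at hn
  linear_combination hn

/-- The area of a triangle in terms of the norms and inner products in the Poincaré ball. -/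
lemma hasHalfArea_of_sides {P Q R : H3} {m₁ m₂ m₃ g₁₂ g₁₃ g₂₃ s : ℝ}
    (hm₁ : m₁ < 1) (hm₂ : m₂ < 1) (hm₃ : m₃ < 1)
    (h₁₂ : -lorentz P Q = ((1 + m₁) * (1 + m₂) - 4 * g₁₂) / ((1 - m₁) * (1 - m₂)))
    (h₁₃ : -lorentz P R = ((1 + m₁) * (1 + m₃) - 4 * g₁₃) / ((1 - m₁) * (1 - m₃)))
    (h₂₃ : -lorentz Q R = ((1 + m₂) * (1 + m₃) - 4 * g₂₃) / ((1 - m₂) * (1 - m₃)))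
    (h : (1 - m₁ * m₂ * m₃ - (1 - m₃) * g₁₂ - (1 - m₂) * g₁₃ - (1 - m₁) * g₂₃) ^ 2 =
      cos s ^ 2 * ((1 + m₁ * m₂ - 2 * g₁₂) * (1 + m₁ * m₃ - 2 * g₁₃) *
        (1 + m₂ * m₃ - 2 * g₂₃))) :
    HasHalfArea P Q R s := by
  have e₁ : 1 - m₁ ≠ 0 := by linarith
  have e₂ : 1 - m₂ ≠ 0 := by linarith
  have e₃ : 1 - m₃ ≠ 0 := by linarith
  have k₁₂ : 1 + -lorentz P Q = 2 * (1 + m₁ * m₂ - 2 * g₁₂) / ((1 - m₁) * (1 - m₂)) := by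
    rw [h₁₂]; field_simp; ring
  have k₁₃ : 1 + -lorentz P R = 2 * (1 + m₁ * m₃ - 2 * g₁₃) / ((1 - m₁) * (1 - m₃)) := by
    rw [h₁₃]; field_simp; ring
  have k₂₃ : 1 + -lorentz Q R = 2 * (1 + m₂ * m₃ - 2 * g₂₃) / ((1 - m₂) * (1 - m₃)) := by
    rw [h₂₃]; field_simp; ring
  have k : 1 + -lorentz P Q + -lorentz P R + -lorentz Q R =
      4 * (1 - m₁ * m₂ * m₃ - (1 - m₃) * g₁₂ - (1 - m₂) * g₁₃ - (1 - m₁) * g₂₃) /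
        ((1 - m₁) * (1 - m₂) * (1 - m₃)) := by
    rw [h₁₂, h₁₃, h₂₃]; field_simp; ring
  rw [HasHalfArea, k, k₁₂, k₁₃, k₂₃, div_pow, mul_pow, h]
  field_simp
  ring

/-- If `φ i = γ i + s i`, this is `cos s * sin (γ 1) * sin (γ 2) * sin (γ 3)`, where `2 * s` is the
area of the base of a tetrahedron with plane angles `γ i` at the apex and with lateral facets of
areas `2 * s i`. -/
def baseNum (s₁ s₂ s₃ γ₁ γ₂ γ₃ : ℝ) : ℝ :=
  sin (γ₁ + s₁) * sin (γ₂ + s₂) * sin (γ₃ + s₃) - sin s₁ * sin s₂ * sin s₃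
    - sin s₁ * cos γ₁ * sin (γ₂ + s₂) * sin (γ₃ + s₃)
    - sin s₂ * cos γ₂ * sin (γ₁ + s₁) * sin (γ₃ + s₃)
    - sin s₃ * cos γ₃ * sin (γ₁ + s₁) * sin (γ₂ + s₂)
    + sin s₂ * sin s₃ * sin (γ₁ + s₁) * cos γ₁
    + sin s₁ * sin s₃ * sin (γ₂ + s₂) * cos γ₂
    + sin s₁ * sin s₂ * sin (γ₃ + s₃) * cos γ₃

/-- Law of sines in the Euclidean triangle with sides 1 and T enclosing γ, and angle s opposite T:
the third side is sin γ / sin (γ + s). -/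
lemma side_sq {s γ T : ℝ} (h : T * sin (γ + s) = sin s) (hφ : 0 < sin (γ + s)) :
    1 + T ^ 2 - 2 * (T * cos γ) = (sin γ / sin (γ + s)) ^ 2 := by
  have hT : T = sin s / sin (γ + s) := by field_simp; linarith
  rw [hT]
  field_simp
  rw [sin_add]
  linear_combination sin γ ^ 2 * sin_sq_add_cos_sq s - sin s ^ 2 * sin_sq_add_cos_sq γ

/-- In the same Euclidean triangle, both sides are the projection of the third side onto the side of
length 1. -/
lemma one_sub_mul_cos {s γ T : ℝ} (h : T * sin (γ + s) = sin s) (hφ : 0 < sin (γ + s)) :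
    1 - T * cos γ = cos s * (sin γ / sin (γ + s)) := by
  have hT : T = sin s / sin (γ + s) := by field_simp; linarith
  rw [hT]
  field_simp
  rw [sin_add]
  ring

/-- `h₁`, `h₂`, `h₃` say that the radii are below 1, `hk` that the three rays at O are not coplanar,
and `hF` that the base has half-area s₄. -/
lemma exists_points_of_angles {s₁ s₂ s₃ s₄ γ₁ γ₂ γ₃ : ℝ}
    (hs₁ : 0 < sin s₁) (hs₂ : 0 < sin s₂) (hs₃ : 0 < sin s₃)
    (hγ₁ : 0 < sin γ₁) (hγ₂ : 0 < sin γ₂)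
    (hφ₁ : 0 < sin (γ₁ + s₁)) (hφ₂ : 0 < sin (γ₂ + s₂)) (hφ₃ : 0 < sin (γ₃ + s₃))
    (h₁ : sin s₂ * sin s₃ * sin (γ₁ + s₁) < sin s₁ * sin (γ₂ + s₂) * sin (γ₃ + s₃))
    (h₂ : sin s₁ * sin s₃ * sin (γ₂ + s₂) < sin s₂ * sin (γ₁ + s₁) * sin (γ₃ + s₃))
    (h₃ : sin s₁ * sin s₂ * sin (γ₃ + s₃) < sin s₃ * sin (γ₁ + s₁) * sin (γ₂ + s₂))
    (hk : (cos γ₃ - cos γ₁ * cos γ₂) ^ 2 < (sin γ₁ * sin γ₂) ^ 2)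
    (hF : baseNum s₁ s₂ s₃ γ₁ γ₂ γ₃ = cos s₄ * (sin γ₁ * sin γ₂ * sin γ₃)) :
    ∃ O P₁ P₂ P₃ : H3, NotCoplanar O P₁ P₂ P₃ ∧ HasHalfArea O P₂ P₃ s₁ ∧
      HasHalfArea O P₁ P₃ s₂ ∧ HasHalfArea O P₁ P₂ s₃ ∧ HasHalfArea P₁ P₂ P₃ s₄ := by
  obtain ⟨T₁, hT₁⟩ : ∃ T, T = sin s₁ / sin (γ₁ + s₁) := ⟨_, rfl⟩
  obtain ⟨T₂, hT₂⟩ : ∃ T, T = sin s₂ / sin (γ₂ + s₂) := ⟨_, rfl⟩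
  obtain ⟨T₃, hT₃⟩ : ∃ T, T = sin s₃ / sin (γ₃ + s₃) := ⟨_, rfl⟩
  have hT₁0 : 0 < T₁ := hT₁ ▸ by positivity
  have hT₂0 : 0 < T₂ := hT₂ ▸ by positivity
  have hT₃0 : 0 < T₃ := hT₃ ▸ by positivity
  have e₁ : T₁ * sin (γ₁ + s₁) = sin s₁ := by rw [hT₁]; field_simp
  have e₂ : T₂ * sin (γ₂ + s₂) = sin s₂ := by rw [hT₂]; field_simp
  have e₃ : T₃ * sin (γ₃ + s₃) = sin s₃ := by rw [hT₃]; field_simp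
  have hp : 0 < sin (γ₁ + s₁) * sin (γ₂ + s₂) * sin (γ₃ + s₃) := by positivity
  have hm₁ : T₂ * T₃ / T₁ < 1 := by
    rw [div_lt_one hT₁0, ← mul_lt_mul_iff_left₀ hp]
    rw [← e₁, ← e₂, ← e₃] at h₁
    linarith
  have hm₂ : T₁ * T₃ / T₂ < 1 := by
    rw [div_lt_one hT₂0, ← mul_lt_mul_iff_left₀ hp]
    rw [← e₁, ← e₂, ← e₃] at h₂
    linarith
  have hm₃ : T₁ * T₂ / T₃ < 1 := by
    rw [div_lt_one hT₃0, ← mul_lt_mul_iff_left₀ hp]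
    rw [← e₁, ← e₂, ← e₃] at h₃
    linarith
  -- These radii solve x₂x₃ = T₁, x₁x₃ = T₂, x₁x₂ = T₃.
  obtain ⟨x₁, hx₁⟩ : ∃ x, x = √(T₂ * T₃ / T₁) := ⟨_, rfl⟩
  obtain ⟨x₂, hx₂⟩ : ∃ x, x = √(T₁ * T₃ / T₂) := ⟨_, rfl⟩
  obtain ⟨x₃, hx₃⟩ : ∃ x, x = √(T₁ * T₂ / T₃) := ⟨_, rfl⟩
  have hx₁0 : 0 < x₁ := hx₁ ▸ by positivity
  have hx₂0 : 0 < x₂ := hx₂ ▸ by positivity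
  have hx₃0 : 0 < x₃ := hx₃ ▸ by positivity
  have f₁ : x₂ * x₃ = T₁ := by
    rw [hx₂, hx₃, ← sqrt_mul (by positivity), ← sqrt_sq hT₁0.le]
    congr 1; field_simp; rw [sqrt_sq hT₁0.le]
  have f₂ : x₁ * x₃ = T₂ := by
    rw [hx₁, hx₃, ← sqrt_mul (by positivity), ← sqrt_sq hT₂0.le]
    congr 1; field_simp; rw [sqrt_sq hT₂0.le]
  have f₃ : x₁ * x₂ = T₃ := by
    rw [hx₁, hx₂, ← sqrt_mul (by positivity), ← sqrt_sq hT₃0.le]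
    congr 1; field_simp; rw [sqrt_sq hT₃0.le]
  have hq₁ : x₁ ^ 2 < 1 := by rwa [hx₁, sq_sqrt (by positivity)]
  have hq₂ : x₂ ^ 2 < 1 := by rwa [hx₂, sq_sqrt (by positivity)]
  have hq₃ : x₃ ^ 2 < 1 := by rwa [hx₃, sq_sqrt (by positivity)]
  clear hx₁ hx₂ hx₃ hm₁ hm₂ hm₃ hT₁ hT₂ hT₃
  -- By the spherical law of cosines, k is the cosine of the dihedral angle along O P₃, and l below
  -- is its sine.
  obtain ⟨k, hkdef⟩ : ∃ k, k = (cos γ₃ - cos γ₁ * cos γ₂) / (sin γ₁ * sin γ₂) := ⟨_, rfl⟩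
  have hk1 : 0 < 1 - k ^ 2 := by
    rw [hkdef, div_pow, sub_pos, div_lt_one (by positivity)]; exact hk
  have hkc : sin γ₁ * sin γ₂ * k = cos γ₃ - cos γ₁ * cos γ₂ := by rw [hkdef]; field_simp
  obtain ⟨l, hl⟩ : ∃ l, l = √(1 - k ^ 2) := ⟨_, rfl⟩
  have hl0 : 0 < l := hl ▸ sqrt_pos.2 hk1
  have hl2 : l ^ 2 = 1 - k ^ 2 := hl ▸ sq_sqrt hk1.le
  have n₁ : (x₁ * cos γ₂) ^ 2 + (x₁ * sin γ₂) ^ 2 + 0 ^ 2 = x₁ ^ 2 := by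
    linear_combination x₁ ^ 2 * sin_sq_add_cos_sq γ₂
  have n₂ : (x₂ * cos γ₁) ^ 2 + (x₂ * (sin γ₁ * k)) ^ 2 + (x₂ * (sin γ₁ * l)) ^ 2 = x₂ ^ 2 := by
    linear_combination x₂ ^ 2 * sin_sq_add_cos_sq γ₁ + x₂ ^ 2 * sin γ₁ ^ 2 * hl2
  have n₃ : x₃ ^ 2 + 0 ^ 2 + 0 ^ 2 = x₃ ^ 2 := by ring
  have n₀ : (0 : ℝ) ^ 2 + 0 ^ 2 + 0 ^ 2 = 0 := by ring
  have r₁ := side_sq e₁ hφ₁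
  have r₂ := side_sq e₂ hφ₂
  have r₃ := side_sq e₃ hφ₃
  have q₁ := one_sub_mul_cos e₁ hφ₁
  have q₂ := one_sub_mul_cos e₂ hφ₂
  have q₃ := one_sub_mul_cos e₃ hφ₃
  have l₀₁ := neg_lorentz_ballPoint n₀ one_pos n₁ hq₁
  have l₀₂ := neg_lorentz_ballPoint n₀ one_pos n₂ hq₂
  have l₀₃ := neg_lorentz_ballPoint n₀ one_pos n₃ hq₃
  have l₁₂ := neg_lorentz_ballPoint n₁ hq₁ n₂ hq₂
  have l₁₃ := neg_lorentz_ballPoint n₁ hq₁ n₃ hq₃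
  have l₂₃ := neg_lorentz_ballPoint n₂ hq₂ n₃ hq₃
  have g₁₂ : x₁ * cos γ₂ * (x₂ * cos γ₁) + x₁ * sin γ₂ * (x₂ * (sin γ₁ * k)) +
      0 * (x₂ * (sin γ₁ * l)) = T₃ * cos γ₃ := by
    linear_combination x₁ * x₂ * hkc + cos γ₃ * f₃
  have g₁₃ : x₁ * cos γ₂ * x₃ + x₁ * sin γ₂ * 0 + 0 * 0 = T₂ * cos γ₂ := by
    linear_combination cos γ₂ * f₂
  have g₂₃ : x₂ * cos γ₁ * x₃ + x₂ * (sin γ₁ * k) * 0 + x₂ * (sin γ₁ * l) * 0 = T₁ * cos γ₁ := by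
    linear_combination cos γ₁ * f₁
  have v₁₂ : x₁ ^ 2 * x₂ ^ 2 = T₃ ^ 2 := by rw [← f₃]; ring
  have v₁₃ : x₁ ^ 2 * x₃ ^ 2 = T₂ ^ 2 := by rw [← f₂]; ring
  have v₂₃ : x₂ ^ 2 * x₃ ^ 2 = T₁ ^ 2 := by rw [← f₁]; ring
  rw [g₁₂] at l₁₂
  rw [g₁₃] at l₁₃
  rw [g₂₃] at l₂₃
  refine ⟨_, _, _, _, ?_, hasHalfArea_of_sides one_pos hq₂ hq₃ l₀₂ l₀₃ l₂₃ ?_,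
    hasHalfArea_of_sides one_pos hq₁ hq₃ l₀₁ l₀₃ l₁₃ ?_,
    hasHalfArea_of_sides one_pos hq₁ hq₂ l₀₁ l₀₂ l₁₂ ?_,
    hasHalfArea_of_sides hq₁ hq₂ hq₃ l₁₂ l₁₃ l₂₃ ?_⟩
  · intro n z₀ z₁ z₂ z₃
    have z₀ := lorentz_ballPoint_eq_zero _ _ z₀
    have z₁ := lorentz_ballPoint_eq_zero _ _ z₁
    have z₂ := lorentz_ballPoint_eq_zero _ _ z₂
    have z₃ := lorentz_ballPoint_eq_zero _ _ z₃
    have y₀ : n 0 = 0 := by linarith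
    have y₁ : n 1 = 0 := by simpa [y₀, hx₃0.ne'] using z₃
    have y₂ : n 2 = 0 := by simpa [y₀, y₁, hx₁0.ne', hγ₂.ne'] using z₁
    have y₃ : n 3 = 0 := by simpa [y₀, y₁, y₂, hx₂0.ne', hγ₁.ne', hl0.ne'] using z₂
    simp [lorentz, y₀, y₁, y₂, y₃]
  · rw [v₂₃, r₁]
    linear_combination (1 - T₁ * cos γ₁ + cos s₁ * (sin γ₁ / sin (γ₁ + s₁))) * q₁
  · rw [v₁₃, r₂]
    linear_combination (1 - T₂ * cos γ₂ + cos s₂ * (sin γ₂ / sin (γ₂ + s₂))) * q₂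
  · rw [v₁₂, r₃]
    linear_combination (1 - T₃ * cos γ₃ + cos s₃ * (sin γ₃ / sin (γ₃ + s₃))) * q₃
  · rw [v₁₂, v₁₃, v₂₃, r₁, r₂, r₃]
    have hD : 1 - T₃ ^ 2 * x₃ ^ 2 - (1 - x₃ ^ 2) * (T₃ * cos γ₃)
        - (1 - x₂ ^ 2) * (T₂ * cos γ₂) - (1 - x₁ ^ 2) * (T₁ * cos γ₁) =
        1 - T₁ * T₂ * T₃ - T₁ * cos γ₁ - T₂ * cos γ₂ - T₃ * cos γ₃ + T₂ * T₃ * cos γ₁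
          + T₁ * T₃ * cos γ₂ + T₁ * T₂ * cos γ₃ := by
      rw [← f₁, ← f₂, ← f₃]; ring
    have hD' : 1 - T₁ * T₂ * T₃ - T₁ * cos γ₁ - T₂ * cos γ₂ - T₃ * cos γ₃ + T₂ * T₃ * cos γ₁
          + T₁ * T₃ * cos γ₂ + T₁ * T₂ * cos γ₃ = cos s₄ * (sin γ₁ / sin (γ₁ + s₁)) *
          (sin γ₂ / sin (γ₂ + s₂)) * (sin γ₃ / sin (γ₃ + s₃)) := by
      rw [baseNum, ← e₁, ← e₂, ← e₃] at hF
      field_simp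
      linear_combination hF
    rw [hD, hD']
    ring

/-! ### Flat positions and the intermediate value argument. -/

/-- The last bracket is minus the Gram determinant of unit vectors with pairwise angles γᵢ, so it
vanishes in flat positions, where the other brackets factor. -/
lemma baseNum_eq (s₁ s₂ s₃ γ₁ γ₂ γ₃ : ℝ) : baseNum s₁ s₂ s₃ γ₁ γ₂ γ₃ =
    cos s₁ * cos s₂ * cos s₃ * (sin γ₁ * sin γ₂ * sin γ₃)
    + cos s₁ * sin s₂ * sin s₃ * (sin γ₁ * (cos γ₁ - cos γ₂ * cos γ₃))
    + sin s₁ * cos s₂ * sin s₃ * (sin γ₂ * (cos γ₂ - cos γ₁ * cos γ₃))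
    + sin s₁ * sin s₂ * cos s₃ * (sin γ₃ * (cos γ₃ - cos γ₁ * cos γ₂))
    + sin s₁ * sin s₂ * sin s₃ *
      (cos γ₁ ^ 2 + cos γ₂ ^ 2 + cos γ₃ ^ 2 - 1 - 2 * cos γ₁ * cos γ₂ * cos γ₃) := by
  simp only [baseNum, sin_add]
  ring

/-- Here the ray O P₃ lies between O P₁ and O P₂, and the base area is a signed sum of the lateral
ones. -/
lemma baseNum_add (s₁ s₂ s₃ γ₁ γ₂ : ℝ) : baseNum s₁ s₂ s₃ γ₁ γ₂ (γ₁ + γ₂) =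
    cos (s₁ + s₂ - s₃) * (sin γ₁ * sin γ₂ * sin (γ₁ + γ₂)) := by
  have e₁ : cos γ₁ - cos γ₂ * cos (γ₁ + γ₂) = sin γ₂ * sin (γ₁ + γ₂) := by
    rw [cos_add, sin_add]; linear_combination (-cos γ₁) * sin_sq_add_cos_sq γ₂
  have e₂ : cos γ₂ - cos γ₁ * cos (γ₁ + γ₂) = sin γ₁ * sin (γ₁ + γ₂) := by
    rw [cos_add, sin_add]; linear_combination (-cos γ₂) * sin_sq_add_cos_sq γ₁
  have e₃ : cos (γ₁ + γ₂) - cos γ₁ * cos γ₂ = -(sin γ₁ * sin γ₂) := by rw [cos_add]; ring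
  have e₄ : cos γ₁ ^ 2 + cos γ₂ ^ 2 + cos (γ₁ + γ₂) ^ 2 - 1 -
      2 * cos γ₁ * cos γ₂ * cos (γ₁ + γ₂) = 0 := by
    rw [cos_add]
    linear_combination sin γ₂ ^ 2 * sin_sq_add_cos_sq γ₁ +
      (1 - cos γ₁ ^ 2) * sin_sq_add_cos_sq γ₂
  rw [baseNum_eq, e₁, e₂, e₃, e₄, cos_sub, cos_add s₁, sin_add s₁]
  ring

/-- The other flat position: O P₂ lies between O P₁ and O P₃. -/
lemma baseNum_sub (s₁ s₂ s₃ γ₁ γ₂ : ℝ) : baseNum s₁ s₂ s₃ γ₁ γ₂ (γ₂ - γ₁) =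
    cos (s₃ + s₁ - s₂) * (sin γ₁ * sin γ₂ * sin (γ₂ - γ₁)) := by
  have e₁ : cos γ₁ - cos γ₂ * cos (γ₂ - γ₁) = sin γ₂ * sin (γ₂ - γ₁) := by
    rw [cos_sub, sin_sub]; linear_combination (-cos γ₁) * sin_sq_add_cos_sq γ₂
  have e₂ : cos γ₂ - cos γ₁ * cos (γ₂ - γ₁) = -(sin γ₁ * sin (γ₂ - γ₁)) := by
    rw [cos_sub, sin_sub]; linear_combination (-cos γ₂) * sin_sq_add_cos_sq γ₁
  have e₃ : cos (γ₂ - γ₁) - cos γ₁ * cos γ₂ = sin γ₁ * sin γ₂ := by rw [cos_sub]; ring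
  have e₄ : cos γ₁ ^ 2 + cos γ₂ ^ 2 + cos (γ₂ - γ₁) ^ 2 - 1 -
      2 * cos γ₁ * cos γ₂ * cos (γ₂ - γ₁) = 0 := by
    rw [cos_sub]
    linear_combination sin γ₂ ^ 2 * sin_sq_add_cos_sq γ₁ +
      (1 - cos γ₁ ^ 2) * sin_sq_add_cos_sq γ₂
  rw [baseNum_eq, e₁, e₂, e₃, e₄, cos_sub, cos_add s₃, sin_add s₃]
  ring

/-- A tetrahedron with prescribed facet areas is found between two flat ones by varying one of the
plane angles at a vertex, while the other two are fixed. -/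
lemma exists_points_of_flat_bounds {s₁ s₂ s₃ s₄ γ₁ γ₂ : ℝ}
    (hs₁ : 0 < s₁) (hs₂ : 0 < s₂) (hs₃ : 0 < s₃)
    (hγ₁ : 0 < γ₁) (hγ : γ₁ < γ₂) (hφ₁ : γ₁ + s₁ < π) (hφ₂ : γ₂ + s₂ < π)
    (hφ₃ : γ₁ + γ₂ + s₃ < π)
    (h : ∀ γ ∈ Ioo (γ₂ - γ₁) (γ₂ + γ₁),
      sin s₁ * sin s₂ * sin (γ + s₃) < sin s₃ * sin (γ₁ + s₁) * sin (γ₂ + s₂) ∧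
      sin s₁ * sin s₃ * sin (γ₂ + s₂) < sin s₂ * sin (γ₁ + s₁) * sin (γ + s₃) ∧
      sin s₂ * sin s₃ * sin (γ₁ + s₁) < sin s₁ * sin (γ₂ + s₂) * sin (γ + s₃))
    (hb : (cos s₄ - cos (s₁ + s₂ - s₃)) * (cos s₄ - cos (s₃ + s₁ - s₂)) < 0) :
    ∃ O P₁ P₂ P₃ : H3, NotCoplanar O P₁ P₂ P₃ ∧ HasHalfArea O P₂ P₃ s₁ ∧
      HasHalfArea O P₁ P₃ s₂ ∧ HasHalfArea O P₁ P₂ s₃ ∧ HasHalfArea P₁ P₂ P₃ s₄ := by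
  have sγ₁ : 0 < sin γ₁ := sin_pos_of_pos_of_lt_pi hγ₁ (by linarith)
  have sγ₂ : 0 < sin γ₂ := sin_pos_of_pos_of_lt_pi (by linarith) (by linarith)
  obtain ⟨γ, hγm, hγ0⟩ : ∃ γ ∈ Ioo (γ₂ - γ₁) (γ₂ + γ₁),
      baseNum s₁ s₂ s₃ γ₁ γ₂ γ - cos s₄ * (sin γ₁ * sin γ₂ * sin γ) = 0 := by
    set f : ℝ → ℝ := fun γ => baseNum s₁ s₂ s₃ γ₁ γ₂ γ - cos s₄ * (sin γ₁ * sin γ₂ * sin γ)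
      with hf
    have hcont : ContinuousOn f (Icc (γ₂ - γ₁) (γ₂ + γ₁)) := by
      simp only [hf, baseNum]; fun_prop
    have hle : γ₂ - γ₁ ≤ γ₂ + γ₁ := by linarith
    have e₁ : f (γ₂ - γ₁) = (cos (s₃ + s₁ - s₂) - cos s₄) *
        (sin γ₁ * sin γ₂ * sin (γ₂ - γ₁)) := by
      simp only [hf, baseNum_sub]; ring
    have e₂ : f (γ₂ + γ₁) = (cos (s₁ + s₂ - s₃) - cos s₄) *
        (sin γ₁ * sin γ₂ * sin (γ₂ + γ₁)) := by
      simp only [hf]; rw [add_comm γ₂ γ₁, baseNum_add]; ring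
    have p₁ : 0 < sin γ₁ * sin γ₂ * sin (γ₂ - γ₁) :=
      mul_pos (mul_pos sγ₁ sγ₂) (sin_pos_of_pos_of_lt_pi (by linarith) (by linarith))
    have p₂ : 0 < sin γ₁ * sin γ₂ * sin (γ₂ + γ₁) :=
      mul_pos (mul_pos sγ₁ sγ₂) (sin_pos_of_pos_of_lt_pi (by linarith) (by linarith))
    rcases mul_neg_iff.1 hb with ⟨ha, hb⟩ | ⟨ha, hb⟩
    · obtain ⟨γ, hγ, h0⟩ := intermediate_value_Ioo' hle hcont (show (0 : ℝ) ∈ Ioo _ _ from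
        ⟨e₂ ▸ mul_neg_of_neg_of_pos (by linarith) p₂, e₁ ▸ mul_pos (by linarith) p₁⟩)
      exact ⟨γ, hγ, h0⟩
    · obtain ⟨γ, hγ, h0⟩ := intermediate_value_Ioo hle hcont (show (0 : ℝ) ∈ Ioo _ _ from
        ⟨e₁ ▸ mul_neg_of_neg_of_pos (by linarith) p₁, e₂ ▸ mul_pos (by linarith) p₂⟩)
      exact ⟨γ, hγ, h0⟩
  obtain ⟨h₃, h₂, h₁⟩ := h γ hγm
  obtain ⟨hl, hu⟩ := hγm
  -- Strictness at both ends keeps the dihedral angle away from 0 and π.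
  have c₁ : cos γ < cos (γ₂ - γ₁) := cos_lt_cos_of_nonneg_of_le_pi (by linarith) (by linarith) hl
  have c₂ : cos (γ₂ + γ₁) < cos γ := cos_lt_cos_of_nonneg_of_le_pi (by linarith) (by linarith) hu
  rw [cos_sub] at c₁
  rw [cos_add] at c₂
  refine exists_points_of_angles (γ₁ := γ₁) (γ₂ := γ₂) (γ₃ := γ)
    (sin_pos_of_pos_of_lt_pi hs₁ (by linarith)) (sin_pos_of_pos_of_lt_pi hs₂ (by linarith))
    (sin_pos_of_pos_of_lt_pi hs₃ (by linarith)) sγ₁ sγ₂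
    (sin_pos_of_pos_of_lt_pi (by linarith) hφ₁) (sin_pos_of_pos_of_lt_pi (by linarith) hφ₂)
    (sin_pos_of_pos_of_lt_pi (by linarith) (by linarith)) h₁ h₂ h₃ ?_ (by linarith)
  exact sq_lt_sq' (by linarith) (by linarith)

/-- The case of `exists_points_of_flat_bounds` where the edges bounding the varying plane angle have
equal lengths. -/
lemma exists_points_of_flat_bounds_of_eq {s₁ s₂ s₃ s₄ γ₁ γ₂ : ℝ}
    (hs₁ : 0 < s₁) (hs₂ : 0 < s₂) (hs₃ : 0 < s₃)
    (hγ₁ : 0 < γ₁) (hγ : γ₁ < γ₂) (hφ₁ : γ₁ + s₁ < π) (hφ₂ : γ₂ + s₂ < π)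
    (hφ₃ : γ₁ + γ₂ + 2 * s₃ < π)
    (h : sin s₁ * sin (γ₂ + s₂) = sin s₂ * sin (γ₁ + s₁))
    (h' : sin s₁ * sin s₂ < sin s₃ * sin (γ₁ + s₁) * sin (γ₂ + s₂))
    (hb : (cos s₄ - cos (s₁ + s₂ - s₃)) * (cos s₄ - cos (s₃ + s₁ - s₂)) < 0) :
    ∃ O P₁ P₂ P₃ : H3, NotCoplanar O P₁ P₂ P₃ ∧ HasHalfArea O P₂ P₃ s₁ ∧
      HasHalfArea O P₁ P₃ s₂ ∧ HasHalfArea O P₁ P₂ s₃ ∧ HasHalfArea P₁ P₂ P₃ s₄ := by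
  refine exists_points_of_flat_bounds hs₁ hs₂ hs₃ hγ₁ hγ hφ₁ hφ₂ (by linarith)
    (fun γ hγm => ?_) hb
  have p₁ : 0 < sin s₁ := sin_pos_of_pos_of_lt_pi hs₁ (by linarith)
  have p₂ : 0 < sin s₂ := sin_pos_of_pos_of_lt_pi hs₂ (by linarith)
  have q₁ : 0 < sin (γ₁ + s₁) := sin_pos_of_pos_of_lt_pi (by linarith) hφ₁
  have q₂ : 0 < sin (γ₂ + s₂) := sin_pos_of_pos_of_lt_pi (by linarith) hφ₂
  -- `h` means T₁ = T₂, hence x₁ = x₂ and x₁² = T₃; this is T₃ < 1.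
  have key : sin s₃ < sin (γ + s₃) := by
    have e := sin_sub_sin (γ + s₃) s₃
    have : 0 < sin ((γ + s₃ - s₃) / 2) :=
      sin_pos_of_pos_of_lt_pi (by linarith [hγm.1]) (by linarith [hγm.2])
    have : 0 < cos ((γ + s₃ + s₃) / 2) :=
      cos_pos_of_mem_Ioo ⟨by linarith [hγm.1, pi_pos], by linarith [hγm.2]⟩
    have : 0 < sin (γ + s₃) - sin s₃ := e ▸ by positivity
    linarith
  refine ⟨(mul_le_of_le_one_right (by positivity) (sin_le_one _)).trans_lt h', ?_, ?_⟩
  · have := mul_lt_mul_of_pos_left key (mul_pos p₂ q₁)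
    linear_combination this + sin s₃ * h
  · have := mul_lt_mul_of_pos_left key (mul_pos p₁ q₂)
    linear_combination this - sin s₃ * h

/-! ### The doubly symmetric tetrahedron. -/

/-- The equation says that an isosceles triangle whose base has half-length with cosh y, and whose
equal sides have cosh β², has half-area s with cos s = C. The difference of its sides is positive at
y = 1 and, since βC ≥ 2, negative at y = β. -/
lemma exists_root {C β : ℝ} (hC0 : 0 < C) (hC1 : C < 1) (hβ : 2 / C ≤ β) :
    ∃ y ∈ Ioo 1 β, y ^ 2 + β ^ 2 = (1 + β ^ 2) * C * y := by
  have h2 : 2 ≤ β * C := by rwa [div_le_iff₀ hC0] at hβ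
  have hβ1 : 2 < β := by
    by_contra! h
    nlinarith
  have hcont : ContinuousOn (fun y : ℝ => y ^ 2 + β ^ 2 - (1 + β ^ 2) * C * y) (Icc 1 β) := by
    fun_prop
  obtain ⟨y, hy, h0⟩ := intermediate_value_Ioo' (by linarith) hcont
    (show (0 : ℝ) ∈ Ioo _ _ from ⟨by nlinarith, by nlinarith⟩)
  exact ⟨y, hy, by linarith⟩

/-- There is a tetrahedron with two mirror planes through opposite edges whose facets have
prescribed areas. -/
lemma exists_points_symm {s t : ℝ} (hs : 0 < s) (hs' : s < π / 2) (ht : 0 < t) (ht' : t < π / 2) :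
    ∃ P Q R S : H3, NotCoplanar P Q R S ∧ HasHalfArea Q R S s ∧ HasHalfArea P R S s ∧
      HasHalfArea P Q S t ∧ HasHalfArea P Q R t := by
  have cs0 : 0 < cos s := cos_pos_of_mem_Ioo ⟨by linarith, hs'⟩
  have ct0 : 0 < cos t := cos_pos_of_mem_Ioo ⟨by linarith, ht'⟩
  have cs1 : cos s < 1 := by
    simpa using cos_lt_cos_of_nonneg_of_le_pi le_rfl (by linarith [pi_pos]) hs
  have ct1 : cos t < 1 := by
    simpa using cos_lt_cos_of_nonneg_of_le_pi le_rfl (by linarith [pi_pos]) ht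
  -- Large enough for both isosceles shapes to exist with the same equal sides.
  obtain ⟨β, hβ⟩ : ∃ β, β = 2 / cos s + 2 / cos t := ⟨_, rfl⟩
  have p₁ : 0 < 2 / cos s := by positivity
  have p₂ : 0 < 2 / cos t := by positivity
  obtain ⟨z, ⟨hz1, hzβ⟩, hz⟩ := exists_root cs0 cs1 (β := β) (by linarith)
  obtain ⟨y, ⟨hy1, hyβ⟩, hy⟩ := exists_root ct0 ct1 (β := β) (by linarith)
  have hyz : y * z < β ^ 2 := by
    rw [sq]; exact mul_lt_mul'' hyβ hzβ (by linarith) (by linarith)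
  have hyz0 : 0 < y * z := by positivity
  have hq : 1 < β ^ 2 / (y * z) := by rwa [one_lt_div hyz0]
  -- u and v are cosh and sinh of half the distance between the midpoints of PQ and RS; that
  -- distance has cosh β²/(yz), which makes the four cross edges equal.
  obtain ⟨u, hu0, hu⟩ : ∃ u, 0 < u ∧ u ^ 2 = (β ^ 2 / (y * z) + 1) / 2 :=
    ⟨_, sqrt_pos.2 (by linarith), sq_sqrt (by linarith)⟩
  obtain ⟨v, hv0, hv⟩ : ∃ v, 0 < v ∧ v ^ 2 = (β ^ 2 / (y * z) - 1) / 2 :=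
    ⟨_, sqrt_pos.2 (by linarith), sq_sqrt (by linarith)⟩
  obtain ⟨p, hp0, hp⟩ : ∃ p, 0 < p ∧ p ^ 2 = y ^ 2 - 1 :=
    ⟨_, sqrt_pos.2 (by nlinarith), sq_sqrt (by nlinarith)⟩
  obtain ⟨q, hq0, hq⟩ : ∃ q, 0 < q ∧ q ^ 2 = z ^ 2 - 1 :=
    ⟨_, sqrt_pos.2 (by nlinarith), sq_sqrt (by nlinarith)⟩
  have huv : u ^ 2 - v ^ 2 = 1 := by rw [hu, hv]; ring
  have huv' : y * z * (u ^ 2 + v ^ 2) = β ^ 2 := by rw [hu, hv]; field_simp; ring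
  have hP : ![y * u, p, 0, -(y * v)] ∈ H3 := by
    refine ⟨?_, by simp only [Matrix.cons_val]; positivity⟩
    simp only [lorentz, Matrix.cons_val]; linear_combination hp - y ^ 2 * huv
  have hQ : ![y * u, -p, 0, -(y * v)] ∈ H3 := by
    refine ⟨?_, by simp only [Matrix.cons_val]; positivity⟩
    simp only [lorentz, Matrix.cons_val]; linear_combination hp - y ^ 2 * huv
  have hR : ![z * u, 0, q, z * v] ∈ H3 := by
    refine ⟨?_, by simp only [Matrix.cons_val]; positivity⟩
    simp only [lorentz, Matrix.cons_val]; linear_combination hq - z ^ 2 * huv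
  have hS : ![z * u, 0, -q, z * v] ∈ H3 := by
    refine ⟨?_, by simp only [Matrix.cons_val]; positivity⟩
    simp only [lorentz, Matrix.cons_val]; linear_combination hq - z ^ 2 * huv
  have ePQ : -lorentz ![y * u, p, 0, -(y * v)] ![y * u, -p, 0, -(y * v)] = 2 * y ^ 2 - 1 := by
    simp only [lorentz, Matrix.cons_val]; linear_combination hp + y ^ 2 * huv
  have eRS : -lorentz ![z * u, 0, q, z * v] ![z * u, 0, -q, z * v] = 2 * z ^ 2 - 1 := by
    simp only [lorentz, Matrix.cons_val]; linear_combination hq + z ^ 2 * huv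
  have ePR : -lorentz ![y * u, p, 0, -(y * v)] ![z * u, 0, q, z * v] = β ^ 2 := by
    simp only [lorentz, Matrix.cons_val]; linear_combination huv'
  have ePS : -lorentz ![y * u, p, 0, -(y * v)] ![z * u, 0, -q, z * v] = β ^ 2 := by
    simp only [lorentz, Matrix.cons_val]; linear_combination huv'
  have eQR : -lorentz ![y * u, -p, 0, -(y * v)] ![z * u, 0, q, z * v] = β ^ 2 := by
    simp only [lorentz, Matrix.cons_val]; linear_combination huv'
  have eQS : -lorentz ![y * u, -p, 0, -(y * v)] ![z * u, 0, -q, z * v] = β ^ 2 := by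
    simp only [lorentz, Matrix.cons_val]; linear_combination huv'
  refine ⟨⟨_, hP⟩, ⟨_, hQ⟩, ⟨_, hR⟩, ⟨_, hS⟩, ?_, ?_, ?_, ?_, ?_⟩
  · intro n z₁ z₂ z₃ z₄
    simp only [lorentz, Matrix.cons_val] at z₁ z₂ z₃ z₄
    have n₁ : n 1 = 0 := by
      have : p * n 1 = 0 := by linarith
      simpa [hp0.ne'] using this
    have n₂ : n 2 = 0 := by
      have : q * n 2 = 0 := by linarith
      simpa [hq0.ne'] using this
    rw [n₁, n₂] at z₁
    rw [n₁, n₂] at z₃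
    have n₀ : n 0 = 0 := by
      have : y * z * u * n 0 = 0 := by linear_combination (-z / 2) * z₁ - y / 2 * z₃
      simpa [hyz0.ne', hu0.ne', (zero_lt_one.trans hy1).ne', (zero_lt_one.trans hz1).ne'] using this
    have n₃ : n 3 = 0 := by
      have : z * v * n 3 = 0 := by linear_combination z₃ + z * u * n₀
      simpa [hv0.ne', (zero_lt_one.trans hz1).ne'] using this
    simp [lorentz, n₀, n₁, n₂, n₃]
  · rw [HasHalfArea, eQR, eQS, eRS]
    linear_combination 4 * (z ^ 2 + β ^ 2 + (1 + β ^ 2) * cos s * z) * hz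
  · rw [HasHalfArea, ePR, ePS, eRS]
    linear_combination 4 * (z ^ 2 + β ^ 2 + (1 + β ^ 2) * cos s * z) * hz
  · rw [HasHalfArea, ePQ, ePS, eQS]
    linear_combination 4 * (y ^ 2 + β ^ 2 + (1 + β ^ 2) * cos t * y) * hy
  · rw [HasHalfArea, ePQ, ePR, eQR]
    linear_combination 4 * (y ^ 2 + β ^ 2 + (1 + β ^ 2) * cos t * y) * hy

/-! ### Choice of base and angles under each hypothesis. -/

/-- Squaring `h` gives sin⁴ t (1 - sin² s) < sin² s (1 - 2 sin² t), that is sin⁴ t < sin² s cos⁴ t.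
-/
lemma tan_sq_lt_sin {s t : ℝ} (hs : 0 < s) (hs' : s < π / 4) (ht : 0 < t) (ht' : t < π / 4)
    (h : (1 - cos (2 * t)) / (2 * √(cos (2 * t))) < tan s) :
    sin t ^ 2 < sin s * cos t ^ 2 := by
  have cs : 0 < cos s := cos_pos_of_mem_Ioo ⟨by linarith, by linarith⟩
  have ss : 0 < sin s := sin_pos_of_pos_of_lt_pi hs (by linarith)
  have c2t : 0 < cos (2 * t) := cos_pos_of_mem_Ioo ⟨by linarith, by linarith⟩
  have hr := sqrt_pos.2 c2t
  have hr2 := sq_sqrt c2t.le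
  rw [tan_eq_sin_div_cos, div_lt_div_iff₀ (by positivity) cs] at h
  have e : cos (2 * t) = 1 - 2 * sin t ^ 2 := by rw [cos_two_mul, cos_sq']; ring
  have h1 : sin t ^ 2 * cos s < sin s * √(cos (2 * t)) := by
    rw [show 1 - cos (2 * t) = 2 * sin t ^ 2 by rw [e]; ring] at h
    linarith
  have h2 : (sin t ^ 2 * cos s) ^ 2 < (sin s * √(cos (2 * t))) ^ 2 :=
    pow_lt_pow_left₀ h1 (by positivity) two_ne_zero
  rw [mul_pow, mul_pow, hr2, e, cos_sq' s] at h2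
  rw [cos_sq' t]
  refine lt_of_pow_lt_pow_left₀ 2 ?_ ?_
  · have : 0 ≤ 1 - sin t ^ 2 := by rw [← cos_sq']; positivity
    positivity
  · linarith

lemma cos_sub_mul_cos_sub_neg {s a b : ℝ} (hs : 0 ≤ s) (ha : |a| < s) (hb : s < b) (hb' : b ≤ π) :
    (cos s - cos a) * (cos s - cos b) < 0 := by
  have h1 : cos s < cos a := by
    rw [← cos_abs a]
    exact cos_lt_cos_of_nonneg_of_le_pi (abs_nonneg a) (by linarith) ha
  have h2 : cos b < cos s := cos_lt_cos_of_nonneg_of_le_pi hs hb' hb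
  exact mul_neg_of_neg_of_pos (by linarith) (by linarith)

section

variable {s₁ s₂ s₃ s₄ : ℝ}

/-- With the s₃ face as base, the flat half-areas are |s₁ + s₂ - s₄| and s₂ + s₄ - s₁. The s₄ face
gets a right angle at the apex, so its two radii have product tan s₄. The other two edges at the
apex are equal, with squared radius at least sin s₁, so `h` bounds the remaining radius by 1. -/
lemma exists_points_of_tan_sq_lt (h₁ : 0 < s₁) (h₁₂ : s₁ ≤ s₂) (h₂₃ : s₂ ≤ s₃) (h₃₄ : s₃ ≤ s₄)
    (h₄ : s₄ < π / 4) (hsum : s₄ < s₁ + s₂ + s₃) (h : sin s₄ ^ 2 < sin s₁ * cos s₄ ^ 2) :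
    ∃ P Q R S : H3, NotCoplanar P Q R S ∧ HasHalfArea Q R S s₁ ∧ HasHalfArea P R S s₂ ∧
      HasHalfArea P Q S s₃ ∧ HasHalfArea P Q R s₄ := by
  by_cases hne : s₁ = s₂ ∧ s₃ = s₄
  · obtain ⟨rfl, rfl⟩ := hne
    exact exists_points_symm h₁ (by linarith) (h₁.trans_le h₂₃) (by linarith)
  -- Only the case just excluded turns either inequality into an equality.
  have hlt : 2 * s₁ < s₂ + s₄ := by
    by_contra! h
    exact hne ⟨by linarith, by linarith⟩
  have hlt' : s₃ + s₁ < s₄ + s₂ := by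
    by_contra! h
    exact hne ⟨by linarith, by linarith⟩
  have p₂ : 0 < sin s₂ := sin_pos_of_pos_of_lt_pi (by linarith) (by linarith)
  have p₄ : 0 < sin s₄ := sin_pos_of_pos_of_lt_pi (by linarith) (by linarith)
  have hsc : sin s₄ < cos s₄ := by
    rw [← cos_pi_div_two_sub]
    exact cos_lt_cos_of_nonneg_of_le_pi (by linarith) (by linarith) (by linarith)
  have hs₂₄ : sin s₂ ≤ sin s₄ := sin_le_sin_of_le_of_le_pi_div_two (by linarith) (by linarith)
    (by linarith)
  -- Chosen so that sin s₂ / sin φ = tan s₄, which makes those two edges equal.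
  obtain ⟨φ, hφ⟩ : ∃ φ, φ = arcsin (sin s₂ * cos s₄ / sin s₄) := ⟨_, rfl⟩
  have hle : sin s₂ * cos s₄ / sin s₄ ≤ cos s₄ := by
    rw [div_le_iff₀ p₄, mul_comm (cos s₄)]
    exact mul_le_mul_of_nonneg_right hs₂₄ (by linarith)
  have hge : sin s₂ < sin s₂ * cos s₄ / sin s₄ := by
    rw [lt_div_iff₀ p₄]
    exact mul_lt_mul_of_pos_left hsc p₂
  have hsin : sin φ = sin s₂ * cos s₄ / sin s₄ := by
    rw [hφ, sin_arcsin (by linarith) (hle.trans (cos_le_one _))]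
  have hφ₁ : s₂ < φ := by
    rw [hφ, lt_arcsin_iff_sin_lt ⟨by linarith, by linarith⟩
      ⟨by linarith, hle.trans (cos_le_one _)⟩]
    exact hge
  have hφ₂ : φ ≤ π / 2 - s₄ := by
    rw [hφ, arcsin_le_iff_le_sin ⟨by linarith, hle.trans (cos_le_one _)⟩
      ⟨by linarith, by linarith⟩, sin_pi_div_two_sub]
    exact hle
  have hsin₄ : sin (π / 2 + s₄) = cos s₄ := by rw [add_comm, sin_add_pi_div_two]
  obtain ⟨R, Q, S, P, hn, a₁, a₂, a₃, a₄⟩ := exists_points_of_flat_bounds_of_eq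
    (s₁ := s₂) (s₂ := s₄) (s₃ := s₁) (s₄ := s₃) (γ₁ := φ - s₂) (γ₂ := π / 2)
    (by linarith) (by linarith) h₁ (by linarith) (by linarith) (by linarith) (by linarith)
    (by linarith)
    (by rw [sub_add_cancel, hsin₄, hsin]; field_simp)
    (by
      rw [sub_add_cancel, hsin₄, hsin]
      rw [show sin s₁ * (sin s₂ * cos s₄ / sin s₄) * cos s₄ =
        sin s₂ * (sin s₁ * cos s₄ ^ 2) / sin s₄ by ring, lt_div_iff₀ p₄]
      linarith [mul_lt_mul_of_pos_left h p₂])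
    (by
      rw [mul_comm]
      exact cos_sub_mul_cos_sub_neg (by linarith)
        (abs_lt.2 ⟨by linarith, by linarith⟩) (by linarith) (by linarith))
  refine ⟨P, Q, R, S, fun n z₁ z₂ z₃ z₄ => hn n z₃ z₂ z₄ z₁, a₃.swap_left,
    a₁.swap_right.swap_left, a₄.swap_right.swap_left, a₂.swap_left.swap_right.swap_left⟩

/-- With the s₁ face as base, the flat half-areas are s₄ - s₂ - s₃ and s₄ + s₂ - s₃. Both radius
products in the s₂ and s₃ faces are set to sin s₄. -/
lemma exists_points_of_add_le_of_lt (h₁ : 0 < s₁) (h₁₂ : s₁ ≤ s₂) (h₂₃ : s₂ < s₃)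
    (h₄ : s₄ < π / 4) (hsum : s₄ < s₁ + s₂ + s₃) (h : s₃ + s₂ ≤ s₄) :
    ∃ P Q R S : H3, NotCoplanar P Q R S ∧ HasHalfArea Q R S s₁ ∧ HasHalfArea P R S s₂ ∧
      HasHalfArea P Q S s₃ ∧ HasHalfArea P Q R s₄ := by
  have p₂ : 0 < sin s₂ := sin_pos_of_pos_of_lt_pi (by linarith) (by linarith)
  have p₃ : 0 < sin s₃ := sin_pos_of_pos_of_lt_pi (by linarith) (by linarith)
  have p₄ : 0 < sin s₄ := sin_pos_of_pos_of_lt_pi (by linarith) (by linarith)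
  have p₄' : sin s₄ < 1 := by
    rw [← sin_pi_div_two]
    exact sin_lt_sin_of_lt_of_le_pi_div_two (by linarith) le_rfl (by linarith)
  have hφ : ∀ s, 0 < s → s < s₄ → ∃ φ, sin φ = sin s / sin s₄ ∧ s < φ ∧ φ ≤ π / 2 := by
    intro s hs hs'
    have ps : 0 < sin s := sin_pos_of_pos_of_lt_pi hs (by linarith)
    have hle : sin s / sin s₄ ≤ 1 := by
      rw [div_le_one p₄]
      exact sin_le_sin_of_le_of_le_pi_div_two (by linarith) (by linarith) hs'.le
    have hge : sin s < sin s / sin s₄ := by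
      rw [lt_div_iff₀ p₄]
      exact mul_lt_of_lt_one_right ps p₄'
    refine ⟨arcsin (sin s / sin s₄), sin_arcsin (by linarith) hle, ?_, arcsin_le_pi_div_two _⟩
    rwa [lt_arcsin_iff_sin_lt ⟨by linarith, by linarith⟩ ⟨by linarith, hle⟩]
  obtain ⟨φ₂, e₂, l₂, u₂⟩ := hφ s₂ (by linarith) (by linarith)
  obtain ⟨φ₃, e₃, l₃, u₃⟩ := hφ s₃ (by linarith) (by linarith)
  have hsq : sin s₂ ^ 2 + sin s₃ ^ 2 ≤ sin s₄ ^ 2 := by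
    have h1 : sin (s₂ + s₃) ≤ sin s₄ :=
      sin_le_sin_of_le_of_le_pi_div_two (by linarith) (by linarith) (by linarith)
    have h2 : 0 ≤ sin (s₂ + s₃) := (sin_pos_of_pos_of_lt_pi (by linarith) (by linarith)).le
    have h3 : 0 ≤ cos (s₂ + s₃) := cos_nonneg_of_mem_Icc ⟨by linarith, by linarith⟩
    have h4 : sin (s₂ + s₃) ^ 2 =
        sin s₂ ^ 2 + sin s₃ ^ 2 + 2 * (sin s₂ * sin s₃ * cos (s₂ + s₃)) := by
      rw [sin_add, cos_add]
      linear_combination sin s₂ ^ 2 * sin_sq_add_cos_sq s₃ + sin s₃ ^ 2 * sin_sq_add_cos_sq s₂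
    have h5 := pow_le_pow_left₀ h2 h1 2
    have : 0 ≤ sin s₂ * sin s₃ * cos (s₂ + s₃) := by positivity
    linarith
  have hφsum : φ₂ + φ₃ ≤ π / 2 := by
    by_contra! hc
    have h1 : cos φ₃ < sin φ₂ := by
      rw [← sin_pi_div_two_sub]
      exact sin_lt_sin_of_lt_of_le_pi_div_two (by linarith) u₂ (by linarith)
    have h2 := pow_lt_pow_left₀ h1 (cos_nonneg_of_mem_Icc ⟨by linarith, u₃⟩) two_ne_zero
    rw [cos_sq', e₂, e₃] at h2
    have h3 : (sin s₂ / sin s₄) ^ 2 + (sin s₃ / sin s₄) ^ 2 ≤ 1 := by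
      rwa [div_pow, div_pow, ← add_div, div_le_one (by positivity)]
    linarith
  -- For fixed d in (0, π), sin (s + d) / sin s = cos d + sin d · cot s decreases in s on (0, π),
  -- while φ₂ and φ₃ give the same ratio 1 / sin s₄; hence the smaller s has the smaller increment.
  have hγ : φ₂ - s₂ < φ₃ - s₃ := by
    by_contra! hc
    have h1 : sin (s₂ + (φ₃ - s₃)) ≤ sin φ₂ :=
      sin_le_sin_of_le_of_le_pi_div_two (by linarith) u₂ (by linarith)
    have h2 : sin (s₂ + (φ₃ - s₃)) * sin s₃ - sin φ₃ * sin s₂ =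
        sin (φ₃ - s₃) * sin (s₃ - s₂) := by
      obtain ⟨d, rfl⟩ : ∃ d, φ₃ = s₃ + d := ⟨φ₃ - s₃, by ring⟩
      simp only [add_sub_cancel_left, sin_add, sin_sub]
      ring
    have h3 : 0 < sin (φ₃ - s₃) * sin (s₃ - s₂) :=
      mul_pos (sin_pos_of_pos_of_lt_pi (by linarith) (by linarith))
        (sin_pos_of_pos_of_lt_pi (by linarith) (by linarith))
    have h4 : sin φ₂ * sin s₃ = sin φ₃ * sin s₂ := by rw [e₂, e₃]; ring
    have := mul_le_mul_of_nonneg_right h1 p₃.le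
    linarith
  obtain ⟨P, Q, R, S, hn, a₂, a₃, a₄, a₁⟩ := exists_points_of_flat_bounds_of_eq
    (s₁ := s₂) (s₂ := s₃) (s₃ := s₄) (s₄ := s₁) (γ₁ := φ₂ - s₂) (γ₂ := φ₃ - s₃)
    (by linarith) (by linarith) (by linarith) (by linarith) hγ (by linarith) (by linarith)
    (by linarith)
    (by rw [sub_add_cancel, sub_add_cancel, e₂, e₃]; ring)
    (by
      rw [sub_add_cancel, sub_add_cancel, e₂, e₃]
      rw [show sin s₄ * (sin s₂ / sin s₄) * (sin s₃ / sin s₄) =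
        sin s₂ * sin s₃ / sin s₄ by field_simp, lt_div_iff₀ p₄]
      exact mul_lt_of_lt_one_right (by positivity) p₄')
    (cos_sub_mul_cos_sub_neg h₁.le (abs_lt.2 ⟨by linarith, by linarith⟩)
      (by linarith) (by linarith))
  exact ⟨P, Q, R, S, hn, a₁, a₂, a₃, a₄⟩

/-- If s₂ = s₃, the previous choice gives γ₁ = γ₂ and the lower flat end collapses to angle 0, where
both sides of the base equation vanish. The angles are therefore taken unequal, giving up the equal
edges. -/
lemma exists_points_of_two_mul_le (h₁ : 0 < s₁) (h₁₂ : s₁ ≤ s₂)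
    (h₄ : s₄ < π / 4) (hsum : s₄ < s₁ + s₂ + s₂) (h : 2 * s₂ ≤ s₄) :
    ∃ P Q R S : H3, NotCoplanar P Q R S ∧ HasHalfArea Q R S s₁ ∧ HasHalfArea P R S s₂ ∧
      HasHalfArea P Q S s₂ ∧ HasHalfArea P Q R s₄ := by
  have p₂ : 0 < sin s₂ := sin_pos_of_pos_of_lt_pi (by linarith) (by linarith)
  have p₄ : 0 < sin s₄ := sin_pos_of_pos_of_lt_pi (by linarith) (by linarith)
  have q₀ : 0 < sin (π / 4) := sin_pos_of_pos_of_lt_pi (by linarith) (by linarith)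
  have hq₀ : 2 * sin (π / 4) ^ 2 = 1 := by
    rw [sin_sq_eq_half_sub, show 2 * (π / 4) = π / 2 by ring, cos_pi_div_two]; ring
  have hsc : sin (π / 4) < cos s₄ := by
    rw [← sin_pi_div_two_sub]
    exact sin_lt_sin_of_lt_of_le_pi_div_two (by linarith) (by linarith) (by linarith)
  have hsc' : 2 * (sin s₄ * cos s₄) < 1 := by
    rw [← mul_assoc, ← sin_two_mul, ← sin_pi_div_two]
    exact sin_lt_sin_of_lt_of_le_pi_div_two (by linarith) le_rfl (by linarith)
  have hss : 2 * sin s₂ ^ 2 < sin s₄ := by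
    have h1 : cos s₄ ≤ cos (2 * s₂) := cos_le_cos_of_nonneg_of_le_pi (by linarith) (by linarith) h
    have h2 : 2 * sin s₂ ^ 2 = 1 - cos (2 * s₂) := by rw [sin_sq_eq_half_sub]; ring
    have h3 : 1 < sin s₄ + cos s₄ := by
      have := cos_le_one s₄
      have h4 : 0 < cos s₄ := q₀.trans hsc
      nlinarith [sin_sq_add_cos_sq s₄, mul_pos p₄ h4]
    linarith
  -- Now γ₂ - γ₁ = π/4 - s₄ and γ₁ + γ₂ < 3π/4 - s₄, so γ + s₄ stays in (π/4, 3π/4), where its sine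
  -- exceeds sin (π/4).
  have key := exists_points_of_flat_bounds (s₁ := s₂) (s₂ := s₂) (s₃ := s₄) (s₄ := s₁)
    (γ₁ := π / 4 - s₂) (γ₂ := π / 2 - s₄ - s₂)
    (by linarith) (by linarith) (by linarith) (by linarith) (by linarith) (by linarith)
    (by linarith) (by linarith) ?_
    (cos_sub_mul_cos_sub_neg h₁.le (abs_lt.2 ⟨by linarith, by linarith⟩)
      (by linarith) (by linarith))
  · obtain ⟨P, Q, R, S, hn, a₂, a₃, a₄, a₁⟩ := key
    exact ⟨P, Q, R, S, hn, a₁, a₂, a₃, a₄⟩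
  rintro γ ⟨hl, hu⟩
  rw [sub_add_cancel, sub_add_cancel, sin_pi_div_two_sub]
  have hγ : sin (π / 4) < sin (γ + s₄) := by
    rw [← cos_pi_div_two_sub (γ + s₄), ← cos_pi_div_two_sub (π / 4), ← cos_abs (π / 2 - (γ + s₄))]
    exact cos_lt_cos_of_nonneg_of_le_pi (abs_nonneg _) (by linarith)
      (abs_lt.2 ⟨by linarith, by linarith⟩)
  have hγ1 := sin_le_one (γ + s₄)
  refine ⟨?_, ?_, ?_⟩
  · have h1 : sin s₂ * sin s₂ * sin (γ + s₄) ≤ sin s₂ * sin s₂ :=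
      mul_le_of_le_one_right (by positivity) hγ1
    have h2 : sin s₄ * sin (π / 4) * sin (π / 4) < sin s₄ * sin (π / 4) * cos s₄ :=
      mul_lt_mul_of_pos_left hsc (by positivity)
    have h3 : sin s₄ * sin (π / 4) * sin (π / 4) = sin s₄ / 2 := by
      linear_combination sin s₄ / 2 * hq₀
    linarith
  · have h1 : sin (π / 4) * sin (π / 4) < sin (π / 4) * sin (γ + s₄) :=
      mul_lt_mul_of_pos_left hγ q₀
    have h2 : sin s₄ * cos s₄ < sin (π / 4) * sin (γ + s₄) := by linarith
    linarith [mul_lt_mul_of_pos_left h2 p₂]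
  · have h1 : sin s₄ * sin (π / 4) ≤ cos s₄ * sin (π / 4) := by
      have : sin s₄ ≤ sin (π / 4) :=
        sin_le_sin_of_le_of_le_pi_div_two (by linarith) (by linarith) h₄.le
      exact mul_le_mul_of_nonneg_right (by linarith) q₀.le
    have h2 : cos s₄ * sin (π / 4) < cos s₄ * sin (γ + s₄) :=
      mul_lt_mul_of_pos_left hγ (by linarith)
    linarith [mul_lt_mul_of_pos_left (h1.trans_lt h2) p₂]

end

end HypSpace

end

theorem theorem3 (S₁ S₂ S₃ S₄ : ℝ)
    (h₁ : 0 < S₁) (h₁₂ : S₁ ≤ S₂) (h₂₃ : S₂ ≤ S₃) (h₃₄ : S₃ ≤ S₄) (h₄ : S₄ < Real.pi / 2)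
    (hsum : S₄ < S₁ + S₂ + S₃)
    (h : (1 - Real.cos S₄) / (2 * √(Real.cos S₄)) < Real.tan (S₁ / 2) ∨ S₃ + S₂ ≤ S₄) :
    ∃ A : Fin 4 → HypSpace.H3,
      HypSpace.NonDegenerate A ∧
      HypSpace.facetArea A 0 = S₁ ∧ HypSpace.facetArea A 1 = S₂ ∧
      HypSpace.facetArea A 2 = S₃ ∧ HypSpace.facetArea A 3 = S₄ := by
  obtain ⟨s₁, rfl⟩ : ∃ s, S₁ = 2 * s := ⟨S₁ / 2, by ring⟩
  obtain ⟨s₂, rfl⟩ : ∃ s, S₂ = 2 * s := ⟨S₂ / 2, by ring⟩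
  obtain ⟨s₃, rfl⟩ : ∃ s, S₃ = 2 * s := ⟨S₃ / 2, by ring⟩
  obtain ⟨s₄, rfl⟩ : ∃ s, S₄ = 2 * s := ⟨S₄ / 2, by ring⟩
  have key : ∃ P Q R S : HypSpace.H3, HypSpace.NotCoplanar P Q R S ∧
      HypSpace.HasHalfArea Q R S s₁ ∧ HypSpace.HasHalfArea P R S s₂ ∧
      HypSpace.HasHalfArea P Q S s₃ ∧ HypSpace.HasHalfArea P Q R s₄ := by
    rcases h with h | h
    · rw [mul_div_cancel_left₀ s₁ two_ne_zero] at h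
      exact HypSpace.exists_points_of_tan_sq_lt (by linarith) (by linarith) (by linarith)
        (by linarith) (by linarith) (by linarith)
        (HypSpace.tan_sq_lt_sin (by linarith) (by linarith) (by linarith) (by linarith) h)
    · rcases h₂₃.lt_or_eq with h' | h'
      · exact HypSpace.exists_points_of_add_le_of_lt (by linarith) (by linarith) (by linarith)
          (by linarith) (by linarith) (by linarith)
      · obtain rfl : s₂ = s₃ := by linarith
        exact HypSpace.exists_points_of_two_mul_le (by linarith) (by linarith) (by linarith)
          (by linarith) (by linarith)
  obtain ⟨P, Q, R, S, hn, a₁, a₂, a₃, a₄⟩ := key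
  exact HypSpace.exists_facetArea hn a₁ a₂ a₃ a₄ ⟨by linarith, by linarith⟩
    ⟨by linarith, by linarith⟩ ⟨by linarith, by linarith⟩ ⟨by linarith, by linarith⟩
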